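/- **Theorem 1.** Let $\beta>0$ and let $V:\mathbb R\to\mathbb R$ be a bounded (measurable) potential. For a finite interval $\Lambda=[a,b]$, $a<b$, of length $|\Lambda|=b-a$, let $h=-\frac{d^2}{dx^2}+V$ in $L^2(\Lambda)$ with Dirichlet boundary conditions, i.e. $h$ has domain $H^2(\Lambda)\cap H^1_0(\Lambda)$. Let $\varepsilon_1^{(V)}(\Lambda)<\varepsilon_2^{(V)}(\Lambda)<\dots$ be the eigenvalues of $h$, listed in increasing order, and let $$Z_N^{(V)}(\Lambda)=\sum_{0<k_1<k_2<\dots<k_N}\exp\Bigl(-\beta\sum_{i=1}^N\varepsilon_{k_i}^{(V)}(\Lambda)\Bigr)$$ be the canonical partition function of $N$ free spinless fermions. These objects are well defined: the eigenvalues of $h$ form an infinite strictly increasing sequence which contains all of them, and the series defining $Z_N^{(V)}(\Lambda)$ converges for every $N$. Let $Z_N^{(0)}(\Lambda)$ be the same quantity for the zero potential. Then, as $N\to\infty$ and $|\Lambda|\to\infty$ in such a way that $N/|\Lambda|\to\infty$, $$\frac{\ln Z_N^{(V)}(\Lambda)}{\ln Z_N^{(0)}(\Lambda)}\longrightarrow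 1 ,$$ where the position of the interval $\Lambda$ on the line may vary arbitrarily along the limit. -/

import Mathlib

open MeasureTheory Filter Topology Set

noncomputable section

namespace FermiGas

/-- The one-particle Hilbert space `L²([a, b]; ℂ)`. -/
abbrev L2 (a b : ℝ) : Type := Lp ℂ 2 (volume.restrict (Icc a b))

/-- `IsDirichletH2 a b f f' w`: on `[a, b]` the function `f` is the indefinite integral of `f'`,
which is absolutely continuous with derivative `w ∈ L²`, and `f` vanishes at both end points.
Thus `f` belongs to `H²(a, b) ∩ H¹₀(a, b)` and `w` is its second (weak) derivative. -/
structure IsDirichletH2 (a b : ℝ) (f f' : ℝ → ℂ) (w : L2 a b) : Prop where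
  eq_integral : ∀ x ∈ Icc a b, f x = f a + ∫ t in a..x, f' t
  deriv_eq_integral : ∀ x ∈ Icc a b, f' x = f' a + ∫ t in a..x, w t
  left : f a = 0
  right : f b = 0

theorem intervalIntegrable_L2 {a b : ℝ} (w : L2 a b) {c d : ℝ} (hc : c ∈ Icc a b)
    (hd : d ∈ Icc a b) : IntervalIntegrable w volume c d := by
  have h : IntegrableOn w (Icc a b) volume :=
    (Lp.memLp w).integrable (by norm_num)
  exact ⟨h.mono_set fun x hx => ⟨hc.1.trans hx.1.le, hx.2.trans hd.2⟩,
    h.mono_set fun x hx => ⟨hd.1.trans hx.1.le, hx.2.trans hc.2⟩⟩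

namespace IsDirichletH2

variable {a b : ℝ} {f f' g g' : ℝ → ℂ} {w z : L2 a b}

theorem continuousOn_deriv (h : IsDirichletH2 a b f f' w) : ContinuousOn f' (Icc a b) := by
  rcases lt_or_ge b a with hab | hab
  · simp [Icc_eq_empty_of_lt hab]
  · have hw : IntegrableOn w (uIcc a b) volume := by
      rw [uIcc_of_le hab]
      exact (Lp.memLp w).integrable (by norm_num)
    have := intervalIntegral.continuousOn_primitive_interval hw
    rw [uIcc_of_le hab] at this
    exact (continuousOn_const.add this).congr h.deriv_eq_integral

theorem intervalIntegrable_deriv (h : IsDirichletH2 a b f f' w) {c d : ℝ} (hc : c ∈ Icc a b)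
    (hd : d ∈ Icc a b) : IntervalIntegrable f' volume c d :=
  (h.continuousOn_deriv.mono (ordConnected_Icc.uIcc_subset hc hd)).intervalIntegrable

theorem continuousOn (h : IsDirichletH2 a b f f' w) : ContinuousOn f (Icc a b) := by
  rcases lt_or_ge b a with hab | hab
  · simp [Icc_eq_empty_of_lt hab]
  · have hw : IntegrableOn f' (uIcc a b) volume := by
      rw [uIcc_of_le hab]
      exact h.continuousOn_deriv.integrableOn_Icc
    have := intervalIntegral.continuousOn_primitive_interval hw
    rw [uIcc_of_le hab] at this
    exact (continuousOn_const.add this).congr h.eq_integral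

theorem add (hf : IsDirichletH2 a b f f' w) (hg : IsDirichletH2 a b g g' z) :
    IsDirichletH2 a b (f + g) (f' + g') (w + z) where
  eq_integral x hx := by
    have ha : a ∈ Icc a b := ⟨le_rfl, hx.1.trans hx.2⟩
    simp only [Pi.add_apply]
    rw [intervalIntegral.integral_add (hf.intervalIntegrable_deriv ha hx)
      (hg.intervalIntegrable_deriv ha hx), hf.eq_integral x hx, hg.eq_integral x hx]
    ring
  deriv_eq_integral x hx := by
    have ha : a ∈ Icc a b := ⟨le_rfl, hx.1.trans hx.2⟩
    have hint : ∫ t in a..x, (w + z) t = ∫ t in a..x, (w t + z t) := by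
      refine intervalIntegral.integral_congr_ae_restrict ?_
      refine ae_restrict_of_ae_restrict_of_subset ?_ (Lp.coeFn_add w z)
      rw [uIoc_of_le hx.1]
      exact fun t ht => ⟨ht.1.le, ht.2.trans hx.2⟩
    simp only [Pi.add_apply]
    rw [hint, intervalIntegral.integral_add (intervalIntegrable_L2 w ha hx)
      (intervalIntegrable_L2 z ha hx), hf.deriv_eq_integral x hx, hg.deriv_eq_integral x hx]
    ring
  left := by simp [hf.left, hg.left]
  right := by simp [hf.right, hg.right]

theorem smul (c : ℂ) (hf : IsDirichletH2 a b f f' w) :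
    IsDirichletH2 a b (c • f) (c • f') (c • w) where
  eq_integral x hx := by
    simp only [Pi.smul_apply]
    rw [intervalIntegral.integral_smul, hf.eq_integral x hx, smul_add]
  deriv_eq_integral x hx := by
    have hint : ∫ t in a..x, (c • w) t = ∫ t in a..x, c • w t := by
      refine intervalIntegral.integral_congr_ae_restrict ?_
      refine ae_restrict_of_ae_restrict_of_subset ?_ (Lp.coeFn_smul c w)
      rw [uIoc_of_le hx.1]
      exact fun t ht => ⟨ht.1.le, ht.2.trans hx.2⟩
    simp only [Pi.smul_apply]
    rw [hint, intervalIntegral.integral_smul, hf.deriv_eq_integral x hx, smul_add]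
  left := by simp [hf.left]
  right := by simp [hf.right]

theorem zero : IsDirichletH2 a b 0 0 (0 : L2 a b) where
  eq_integral x hx := by simp
  deriv_eq_integral x hx := by
    have hint : ∫ t in a..x, (0 : L2 a b) t = ∫ t in a..x, (0 : ℂ) := by
      refine intervalIntegral.integral_congr_ae_restrict ?_
      refine ae_restrict_of_ae_restrict_of_subset ?_ (Lp.coeFn_zero ℂ 2 _)
      rw [uIoc_of_le hx.1]
      exact fun t ht => ⟨ht.1.le, ht.2.trans hx.2⟩
    rw [hint]
    simp
  left := rfl
  right := rfl

/-- The second derivative of the zero element of `L²` is zero. -/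
theorem snd_deriv_eq_zero (h : IsDirichletH2 a b f f' w)
    (h0 : f =ᵐ[volume.restrict (Icc a b)] 0) : w = 0 := by
  have hI : Ioo a b =ᵐ[volume] Icc a b := Ioo_ae_eq_Icc
  rcases le_or_gt b a with hab | hab
  · have hμ : volume.restrict (Icc a b) = 0 := by
      rw [Measure.restrict_eq_zero]; simp [hab]
    refine Lp.ext ?_
    have hbot : ae (volume.restrict (Icc a b)) = ⊥ := by rw [hμ, ae_zero]
    rw [EventuallyEq, hbot]
    exact eventually_bot
  have hf : ∀ x ∈ Icc a b, f x = 0 := fun x hx =>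
    Measure.eqOn_Icc_of_ae_eq volume hab.ne h0 h.continuousOn continuousOn_const hx
  have ha : a ∈ Icc a b := left_mem_Icc.2 hab.le
  have hb : b ∈ Icc a b := right_mem_Icc.2 hab.le
  have hf' : ∀ x ∈ Ioo a b, f' x = 0 := by
    intro x hx
    have hxI := Ioo_subset_Icc_self hx
    have hnhds : Icc a b ∈ 𝓝 x := Icc_mem_nhds hx.1 hx.2
    have hd : HasDerivAt (fun y => ∫ t in a..y, f' t) (f' x) x :=
      intervalIntegral.integral_hasDerivAt_right (h.intervalIntegrable_deriv ha hxI)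
        ((h.continuousOn_deriv.mono Ioo_subset_Icc_self).stronglyMeasurableAtFilter
          isOpen_Ioo x hx)
        (h.continuousOn_deriv.continuousAt hnhds)
    have hz : HasDerivAt (fun y => ∫ t in a..y, f' t) 0 x := by
      refine (hasDerivAt_const x (0 : ℂ)).congr_of_eventuallyEq ?_
      filter_upwards [hnhds] with y hy
      have := h.eq_integral y hy
      rw [hf y hy, hf a ha, zero_add] at this
      exact this.symm
    exact hd.unique hz
  refine Lp.ext ?_
  refine EventuallyEq.trans ?_ (Lp.coeFn_zero ℂ 2 _).symm
  have hae : ae (volume.restrict (Icc a b)) = ae (volume.restrict (Ioo a b)) := by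
    rw [Measure.restrict_congr_set hI]
  rw [EventuallyEq, hae, ae_restrict_iff' measurableSet_Ioo]
  filter_upwards [(intervalIntegrable_L2 w ha hb).ae_hasDerivAt_integral] with x hx hxI
  rw [uIcc_of_le hab.le] at hx
  have hd := hx (Ioo_subset_Icc_self hxI) a ha
  have hz : HasDerivAt (fun y => ∫ t in a..y, w t) 0 x := by
    refine (hasDerivAt_const x (-f' a)).congr_of_eventuallyEq ?_
    filter_upwards [Ioo_mem_nhds hxI.1 hxI.2] with y hy
    have := h.deriv_eq_integral y (Ioo_subset_Icc_self hy)
    rw [hf' y hy] at this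
    exact eq_neg_of_add_eq_zero_right this.symm
  exact hd.unique hz

end IsDirichletH2

/-- The graph of `h = -d²/dx² + V` on `L²([a, b])` with Dirichlet boundary conditions: the pairs
`(u, v)` such that `u` has a representative `f ∈ H² ∩ H¹₀` and `v = -f'' + V f`. -/
def hamiltonianGraph (V : ℝ → ℝ) (a b : ℝ) : Submodule ℂ (L2 a b × L2 a b) where
  carrier := {p | ∃ (f f' : ℝ → ℂ) (w : L2 a b), IsDirichletH2 a b f f' w ∧
    p.1 =ᵐ[volume.restrict (Icc a b)] f ∧
    p.2 =ᵐ[volume.restrict (Icc a b)] fun x => -w x + (V x : ℂ) * f x}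
  add_mem' := by
    rintro ⟨u, v⟩ ⟨u', v'⟩ ⟨f, f', w, hf, hu, hv⟩ ⟨g, g', z, hg, hu', hv'⟩
    refine ⟨f + g, f' + g', w + z, hf.add hg, (Lp.coeFn_add u u').trans (hu.add hu'), ?_⟩
    filter_upwards [Lp.coeFn_add v v', Lp.coeFn_add w z, hv, hv'] with x h1 h2 h3 h4
    change (v + v') x = _
    rw [h1, h2]
    simp only [Pi.add_apply] at *
    rw [h3, h4]
    ring
  zero_mem' := by
    refine ⟨0, 0, 0, IsDirichletH2.zero, Lp.coeFn_zero ℂ 2 _, ?_⟩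
    filter_upwards [Lp.coeFn_zero ℂ 2 (volume.restrict (Icc a b))] with x h1
    change (0 : L2 a b) x = _
    rw [h1]
    simp
  smul_mem' := by
    rintro c ⟨u, v⟩ ⟨f, f', w, hf, hu, hv⟩
    refine ⟨c • f, c • f', c • w, hf.smul c, (Lp.coeFn_smul c u).trans (hu.const_smul c), ?_⟩
    filter_upwards [Lp.coeFn_smul c v, Lp.coeFn_smul c w, hv] with x h1 h2 h3
    change (c • v) x = _
    rw [h1, h2]
    simp only [Pi.smul_apply, smul_eq_mul] at *
    rw [h3]
    ring

theorem hamiltonianGraph_snd_eq_zero (V : ℝ → ℝ) (a b : ℝ) (p : L2 a b × L2 a b)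
    (hp : p ∈ hamiltonianGraph V a b) (h0 : p.1 = 0) : p.2 = 0 := by
  obtain ⟨f, f', w, hf, hu, hv⟩ := hp
  rw [h0] at hu
  have hf0 := hu.symm.trans (Lp.coeFn_zero ℂ 2 _)
  have hw := hf.snd_deriv_eq_zero hf0
  subst hw
  refine Lp.ext ?_
  filter_upwards [hv, hf0, Lp.coeFn_zero ℂ 2 (volume.restrict (Icc a b))] with x h1 h2 h3
  rw [h1, h2, h3]
  simp

/-- The one-particle Hamiltonian `h = -d²/dx² + V` on `L²([a, b])` with Dirichlet boundary
conditions, as an unbounded operator. -/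
def hamiltonian (V : ℝ → ℝ) (a b : ℝ) : L2 a b →ₗ.[ℂ] L2 a b :=
  (hamiltonianGraph V a b).toLinearPMap

theorem hamiltonian_graph (V : ℝ → ℝ) (a b : ℝ) :
    (hamiltonian V a b).graph = hamiltonianGraph V a b :=
  Submodule.toLinearPMap_graph_eq _ (hamiltonianGraph_snd_eq_zero V a b)

/-- The set of (real) eigenvalues of `h`. -/
def eigenvalues (V : ℝ → ℝ) (a b : ℝ) : Set ℝ :=
  {E | ∃ u : (hamiltonian V a b).domain, (u : L2 a b) ≠ 0 ∧
    hamiltonian V a b u = (E : ℂ) • (u : L2 a b)}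

/-- The eigenvalues of `h` listed in increasing order; `energy V a b k` is the `(k + 1)`-st one,
that is, the list `ε₁ < ε₂ < …` is `energy V a b 0 < energy V a b 1 < …`. -/
def energy (V : ℝ → ℝ) (a b : ℝ) : ℕ → ℝ
  | 0 => sInf (eigenvalues V a b)
  | k + 1 => sInf {E ∈ eigenvalues V a b | energy V a b k < E}

/-- The Boltzmann weight `exp (-β ∑ ε_{kᵢ})` of the `N`-particle configuration in which the levels
`k₁ < ⋯ < k_N`, given as an `N`-element set, are occupied. -/
def boltzmannWeight (β : ℝ) (V : ℝ → ℝ) (a b : ℝ) (N : ℕ) (s : {s : Finset ℕ // s.card = N}) : ℝ :=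
  Real.exp (-β * ∑ k ∈ s.1, energy V a b k)

/-- The canonical partition function `Z_N^{(V)}` of `N` free spinless fermions on `[a, b]`. -/
def partitionFunction (β : ℝ) (V : ℝ → ℝ) (a b : ℝ) (N : ℕ) : ℝ :=
  ∑' s : {s : Finset ℕ // s.card = N}, boltzmannWeight β V a b N s

end FermiGas

end

/-! The numerator and denominator differ by at most a multiple of `N`, while the denominator is far
larger than `N` in absolute value.

If `|V| ≤ C`, each level of `V` lies within `C` of the corresponding free level (`energy_le_add`).
Each `N`-particle weight thus changes by a factor between `exp (-β C N)` and `exp (β C N)`, and so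
does the whole sum (`log_partitionFunction_le_add`). For the free gas, dominating the canonical sum
by the grand-canonical product at fugacity `z = N / A`, where `A` bounds the one-particle sum, gives
`log Z ≤ N (1 - log (N / A))` (`log_partitionFunction_le`). The levels grow at least linearly with
slope `π / (b - a)` (`le_energy`), so `A` may be taken proportional to `b - a`. Hence `-log Z ≥ N v`
with `v → ∞` at high density, and the ratio is within `β C / v` of `1`.

The spectral facts come from the Prüfer angle `θ`, which solves `θ' = cos² θ + (E - V) sin² θ` with
`θ a = 0`: `E` is an eigenvalue exactly when `θ b` is a multiple of `π`. As a function of `E`, the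
phase `θ b` is positive, continuous, strictly increasing and unbounded above, and at most `π / 4`
for low `E`. The levels are therefore the solutions of `Φ E = (k + 1) π`, and comparing phases
compares levels without a variational principle. -/

noncomputable section

namespace FermiGas

/-! ### Calculus of absolutely continuous functions -/

/-- `f` is absolutely continuous on `[a, b]`, with almost everywhere derivative `f'`. -/
structure HasACDeriv {E : Type*} [NormedAddCommGroup E] [NormedSpace ℝ E]
    (f f' : ℝ → E) (a b : ℝ) : Prop where
  ac : AbsolutelyContinuousOnInterval f a b
  deriv : ∀ᵐ x, x ∈ Icc a b → HasDerivAt f (f' x) x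

theorem ae_mem_Ioo_of_mem_Icc (a b : ℝ) : ∀ᵐ x : ℝ, x ∈ Icc a b → x ∈ Ioo a b := by
  have h₁ : ∀ᵐ x : ℝ, x ≠ a := by simp [ae_iff, measure_singleton]
  have h₂ : ∀ᵐ x : ℝ, x ≠ b := by simp [ae_iff, measure_singleton]
  filter_upwards [h₁, h₂] with x h1 h2 hx
  exact ⟨lt_of_le_of_ne hx.1 h1.symm, lt_of_le_of_ne hx.2 h2⟩

theorem absolutelyContinuousOnInterval_congr {X : Type*} [PseudoMetricSpace X] {f g : ℝ → X}
    {a b : ℝ} (hf : AbsolutelyContinuousOnInterval f a b) (h : EqOn f g (uIcc a b)) :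
    AbsolutelyContinuousOnInterval g a b := by
  rw [absolutelyContinuousOnInterval_iff] at hf ⊢
  intro ε hε
  obtain ⟨δ, hδ, H⟩ := hf ε hε
  refine ⟨δ, hδ, fun I hI hs => ?_⟩
  convert H I hI hs using 3 with i hi
  · exact (h (hI.1 i hi).1).symm
  · exact (h (hI.1 i hi).2).symm

theorem absolutelyContinuousOnInterval_of_dist_le {X Y : Type*} [PseudoMetricSpace X]
    [PseudoMetricSpace Y] {f : ℝ → X} {g : ℝ → Y} {a b : ℝ}
    (hg : AbsolutelyContinuousOnInterval g a b)
    (h : ∀ x ∈ uIcc a b, ∀ y ∈ uIcc a b, dist (f x) (f y) ≤ dist (g x) (g y)) :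
    AbsolutelyContinuousOnInterval f a b := by
  rw [absolutelyContinuousOnInterval_iff] at hg ⊢
  intro ε hε
  obtain ⟨δ, hδ, H⟩ := hg ε hε
  refine ⟨δ, hδ, fun I hI hs => (Finset.sum_le_sum fun i hi => ?_).trans_lt (H I hI hs)⟩
  exact h _ (hI.1 i hi).1 _ (hI.1 i hi).2

theorem absolutelyContinuousOnInterval_integral {E : Type*} [NormedAddCommGroup E]
    [NormedSpace ℝ E] {f : ℝ → E} {a b : ℝ} (hf : IntervalIntegrable f volume a b) :
    AbsolutelyContinuousOnInterval (fun x => ∫ t in a..x, f t) a b := by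
  -- Increments of the primitive are dominated by those of the real primitive of `‖f‖`.
  refine absolutelyContinuousOnInterval_of_dist_le
    (hf.norm.absolutelyContinuousOnInterval_intervalIntegral (c := a) left_mem_uIcc)
    fun x hx y hy => ?_
  have hi : ∀ z ∈ uIcc a b, IntervalIntegrable f volume a z := fun z hz =>
    hf.mono_set (uIcc_subset_uIcc_left hz)
  rw [dist_eq_norm, dist_eq_norm, intervalIntegral.integral_interval_sub_left (hi x hx) (hi y hy),
    intervalIntegral.integral_interval_sub_left (hi x hx).norm (hi y hy).norm, Real.norm_eq_abs]
  exact intervalIntegral.norm_integral_le_abs_integral_norm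

theorem _root_.LipschitzOnWith.comp_absolutelyContinuousOnInterval {X Y : Type*}
    [PseudoMetricSpace X] [PseudoMetricSpace Y] {f : ℝ → X} {g : X → Y} {K : NNReal} {s : Set X}
    {a b : ℝ} (hg : LipschitzOnWith K g s) (hf : AbsolutelyContinuousOnInterval f a b)
    (hs : MapsTo f (uIcc a b) s) : AbsolutelyContinuousOnInterval (fun x => g (f x)) a b := by
  rw [absolutelyContinuousOnInterval_iff] at hf ⊢
  intro ε hε
  obtain ⟨δ, hδ, H⟩ := hf (ε / (K + 1)) (by positivity)
  refine ⟨δ, hδ, fun I hI hI' => ?_⟩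
  calc _ ≤ ∑ i ∈ Finset.range I.1, (K + 1 : ℝ) * dist (f (I.2 i).1) (f (I.2 i).2) := by
        refine Finset.sum_le_sum fun i hi => ?_
        refine (hg.dist_le_mul _ (hs (hI.1 i hi).1) _ (hs (hI.1 i hi).2)).trans ?_
        gcongr
        linarith
    _ = (K + 1) * ∑ i ∈ Finset.range I.1, dist (f (I.2 i).1) (f (I.2 i).2) := by
        rw [Finset.mul_sum]
    _ < (K + 1) * (ε / (K + 1)) := by gcongr; exact H I hI hI'
    _ = ε := by field

namespace HasACDeriv

section Vector

variable {E : Type*} [NormedAddCommGroup E] [NormedSpace ℝ E] {f f' g g' : ℝ → E} {a b : ℝ}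

theorem of_integral [CompleteSpace E] (hab : a ≤ b) (hg : IntervalIntegrable f' volume a b)
    (h : ∀ x ∈ Icc a b, f x = f a + ∫ t in a..x, f' t) : HasACDeriv f f' a b := by
  constructor
  · have h1 := absolutelyContinuousOnInterval_integral hg
    have h2 : AbsolutelyContinuousOnInterval (fun _ : ℝ => f a) a b :=
      (LipschitzWith.const (f a)).lipschitzOnWith.absolutelyContinuousOnInterval
    refine absolutelyContinuousOnInterval_congr (h2.add h1) fun x hx => ?_
    rw [uIcc_of_le hab] at hx
    simp [h x hx]
  · filter_upwards [hg.ae_hasDerivAt_integral, ae_mem_Ioo_of_mem_Icc a b] with x h1 h2 hx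
    rw [uIcc_of_le hab] at h1
    have := (h1 hx a (left_mem_Icc.2 hab)).const_add (f a)
    refine this.congr_of_eventuallyEq ?_
    filter_upwards [Icc_mem_nhds (h2 hx).1 (h2 hx).2] with y hy using h y hy

theorem continuousOn (hf : HasACDeriv f f' a b) : ContinuousOn f (Icc a b) := by
  rcases le_total a b with hab | hab
  · simpa [uIcc_of_le hab] using hf.ac.continuousOn
  · exact (Set.subsingleton_Icc_of_ge hab).continuousOn f

theorem mono (hf : HasACDeriv f f' a b) {c d : ℝ} (hc : c ∈ Icc a b) (hd : d ∈ Icc a b) :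
    HasACDeriv f f' c d := by
  have hab := hc.1.trans hc.2
  refine ⟨hf.ac.mono ?_, ?_⟩
  · rw [uIcc_of_le hab]
    exact ordConnected_Icc.uIcc_subset hc hd
  · filter_upwards [hf.deriv] with x hx hx'
    exact hx ⟨hc.1.trans hx'.1, hx'.2.trans hd.2⟩

theorem congr_deriv (hf : HasACDeriv f f' a b) (h : ∀ᵐ x, x ∈ Icc a b → f' x = g' x) :
    HasACDeriv f g' a b := by
  refine ⟨hf.ac, ?_⟩
  filter_upwards [hf.deriv, h] with x h1 h2 hx
  rw [← h2 hx]
  exact h1 hx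

theorem add (hf : HasACDeriv f f' a b) (hg : HasACDeriv g g' a b) :
    HasACDeriv (fun x => f x + g x) (fun x => f' x + g' x) a b := by
  refine ⟨hf.ac.add hg.ac, ?_⟩
  filter_upwards [hf.deriv, hg.deriv] with x h1 h2 hx using (h1 hx).add (h2 hx)

theorem sub (hf : HasACDeriv f f' a b) (hg : HasACDeriv g g' a b) :
    HasACDeriv (fun x => f x - g x) (fun x => f' x - g' x) a b := by
  refine ⟨hf.ac.sub hg.ac, ?_⟩
  filter_upwards [hf.deriv, hg.deriv] with x h1 h2 hx using (h1 hx).sub (h2 hx)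

theorem smul {c c' : ℝ → ℝ} (hc : HasACDeriv c c' a b) (hf : HasACDeriv f f' a b) :
    HasACDeriv (fun x => c x • f x) (fun x => c x • f' x + c' x • f x) a b := by
  refine ⟨hc.ac.smul hf.ac, ?_⟩
  filter_upwards [hc.deriv, hf.deriv] with x h1 h2 hx using (h1 hx).smul (h2 hx)

theorem eq_left (hf : HasACDeriv f f' a b) (h0 : ∀ᵐ x, x ∈ Icc a b → f' x = 0) :
    ∀ x ∈ Icc a b, f x = f a := by
  intro x hx
  have hab := hx.1.trans hx.2
  have : ∀ᵐ x, x ∈ uIcc a b → HasDerivAt f 0 x := by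
    filter_upwards [hf.deriv, h0] with x h1 h2 hx
    rw [uIcc_of_le hab] at hx
    rw [← h2 hx]
    exact h1 hx
  obtain ⟨C, hC⟩ := hf.ac.const_of_ae_hasDerivAt_zero this
  rw [uIcc_of_le hab] at hC
  rw [hC x hx, hC a (left_mem_Icc.2 hab)]

theorem eq_integral [CompleteSpace E] (hf : HasACDeriv f f' a b)
    (hf' : IntervalIntegrable f' volume a b) :
    ∀ x ∈ Icc a b, f x = f a + ∫ t in a..x, f' t := by
  intro x hx
  have h : HasACDeriv (fun x => ∫ t in a..x, f' t) f' a b :=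
    of_integral (hx.1.trans hx.2) hf' (by simp)
  have := (hf.sub h).eq_left (by simp) x hx
  simp only [intervalIntegral.integral_same, sub_zero] at this
  rw [← this]
  abel

end Vector

variable {f f' g g' : ℝ → ℝ} {a b : ℝ}

theorem mul (hf : HasACDeriv f f' a b) (hg : HasACDeriv g g' a b) :
    HasACDeriv (fun x => f x * g x) (fun x => f' x * g x + f x * g' x) a b := by
  refine ⟨hf.ac.mul hg.ac, ?_⟩
  filter_upwards [hf.deriv, hg.deriv] with x h1 h2 hx using (h1 hx).mul (h2 hx)

theorem of_hasDerivAt (hab : a ≤ b) (h : ∀ x, HasDerivAt f (f' x) x) (hc : Continuous f') :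
    HasACDeriv f f' a b := by
  refine of_integral hab (hc.intervalIntegrable _ _) fun x _ => ?_
  rw [intervalIntegral.integral_eq_sub_of_hasDerivAt (fun x _ => h x) (hc.intervalIntegrable _ _)]
  ring

/-- An absolutely continuous function is bounded on the interval, and a C¹ function is Lipschitz on
a bounded interval. -/
theorem comp {φ φ' : ℝ → ℝ} (hφ : ∀ x, HasDerivAt φ (φ' x) x) (hc : Continuous φ')
    (hf : HasACDeriv f f' a b) : HasACDeriv (fun x => φ (f x)) (fun x => φ' (f x) * f' x) a b := by
  constructor
  · obtain ⟨C, hC⟩ := hf.ac.exists_bound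
    have hφ1 : ContDiff ℝ 1 φ := by
      rw [contDiff_one_iff_deriv]
      refine ⟨fun x => (hφ x).differentiableAt, ?_⟩
      rwa [show _root_.deriv φ = φ' from funext fun x => (hφ x).deriv]
    obtain ⟨K, hK⟩ := hφ1.contDiffOn.exists_lipschitzOnWith (s := Icc (-C) C) (by simp)
      (convex_Icc _ _) isCompact_Icc
    exact hK.comp_absolutelyContinuousOnInterval hf.ac fun x hx => abs_le.1 (hC x hx)
  · filter_upwards [hf.deriv] with x h1 hx using (hφ (f x)).comp x (h1 hx)

theorem monotoneOn (hf : HasACDeriv f f' a b) (h0 : ∀ᵐ x, x ∈ Icc a b → 0 ≤ f' x) :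
    MonotoneOn f (Icc a b) := by
  intro x hx y hy hxy
  have h := (hf.mono hx hy)
  have h1 := h.ac.integral_deriv_eq_sub
  have h2 : 0 ≤ ∫ t in x..y, _root_.deriv f t := by
    refine intervalIntegral.integral_nonneg_of_ae_restrict hxy ?_
    rw [EventuallyLE, ae_restrict_iff' measurableSet_Icc]
    filter_upwards [hf.deriv, h0] with t h1 h2 ht
    have : t ∈ Icc a b := ⟨hx.1.trans ht.1, ht.2.trans hy.2⟩
    rw [(h1 this).deriv]
    exact h2 this
  linarith

end HasACDeriv

/-! ### Differential inequalities -/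

/-- Squaring makes the negative part C¹, so that the chain rule `HasACDeriv.comp` applies to it. -/
theorem hasDerivAt_min_zero_sq (x : ℝ) :
    HasDerivAt (fun y : ℝ => min y 0 ^ 2) (2 * min x 0) x := by
  rcases lt_trichotomy x 0 with hx | rfl | hx
  · rw [min_eq_left hx.le]
    have h : HasDerivAt (fun y : ℝ => y ^ 2) (2 * x) x := by simpa using hasDerivAt_pow 2 x
    refine h.congr_of_eventuallyEq ?_
    filter_upwards [gt_mem_nhds hx] with y hy
    rw [min_eq_left (le_of_lt hy)]
  · rw [hasDerivAt_iff_isLittleO]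
    have h1 : (fun y : ℝ => min y 0 ^ 2) =O[𝓝 0] fun y : ℝ => y ^ 2 := by
      refine Asymptotics.IsBigO.of_bound 1 (Eventually.of_forall fun y => ?_)
      rw [one_mul, norm_pow, norm_pow, Real.norm_eq_abs, Real.norm_eq_abs]
      refine pow_le_pow_left₀ (abs_nonneg _) ?_ 2
      rcases le_total y 0 with h | h <;> simp [h]
    have h2 : (fun y : ℝ => y ^ 2) =o[𝓝 0] fun y : ℝ => y := by
      simpa using Asymptotics.isLittleO_pow_id (𝕜 := ℝ) (n := 2) (by norm_num)
    simpa using h1.trans_isLittleO h2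
  · rw [min_eq_right hx.le, mul_zero]
    refine (hasDerivAt_const x (0 : ℝ)).congr_of_eventuallyEq ?_
    filter_upwards [lt_mem_nhds hx] with y hy
    rw [min_eq_right (le_of_lt hy)]
    norm_num

namespace HasACDeriv

variable {D D' : ℝ → ℝ} {a b K : ℝ}

theorem exp_mul (hD : HasACDeriv D D' a b) (hab : a ≤ b) (K : ℝ) :
    HasACDeriv (fun x => Real.exp (K * x) * D x) (fun x => Real.exp (K * x) * (K * D x + D' x))
      a b := by
  have h : HasACDeriv (fun x => Real.exp (K * x)) (fun x => K * Real.exp (K * x)) a b := by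
    refine of_hasDerivAt hab (fun x => ?_) (by fun_prop)
    have := ((hasDerivAt_id x).const_mul K).exp
    simpa [mul_comm] using this
  refine (h.mul hD).congr_deriv (Eventually.of_forall fun x _ => ?_)
  ring

/-- A differential inequality `D' ≥ -K |D|` preserves nonnegativity. -/
theorem nonneg (hD : HasACDeriv D D' a b) (h : ∀ᵐ x, x ∈ Icc a b → -(K * |D x|) ≤ D' x)
    (ha : 0 ≤ D a) : ∀ x ∈ Icc a b, 0 ≤ D x := by
  intro x hx
  have hab := hx.1.trans hx.2
  -- Where `D ≤ 0` the hypothesis reads `D' ≥ K D`, so `D D' ≤ K D²`: the function `exp (-2 K x)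
  -- (min D 0)²` is nonincreasing. It starts at `0`, hence vanishes.
  have hN := ((hD.comp hasDerivAt_min_zero_sq (by fun_prop)).exp_mul hab (-(2 * K)))
  have h0 : HasACDeriv (fun _ : ℝ => (0 : ℝ)) (fun _ => 0) a b :=
    of_hasDerivAt hab (fun x => hasDerivAt_const x 0) continuous_const
  have hm := (h0.sub hN).monotoneOn (by
    filter_upwards [h] with t ht hx
    have := ht hx
    rw [zero_sub, Left.nonneg_neg_iff]
    refine mul_nonpos_of_nonneg_of_nonpos (Real.exp_pos _).le ?_
    rcases le_total (D t) 0 with h | h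
    · rw [abs_of_nonpos h] at this
      rw [min_eq_left h]
      nlinarith
    · simp [h]) (left_mem_Icc.2 hab) hx hx.1
  simp only [min_eq_right ha] at hm
  have h1 := Real.exp_pos (-(2 * K) * x)
  have h2 : min (D x) 0 ^ 2 ≤ 0 := by
    by_contra! h3
    have := mul_pos h1 h3
    rw [zero_sub, zero_sub, zero_pow two_ne_zero, mul_zero] at hm
    linarith
  have h3 : min (D x) 0 = 0 := pow_eq_zero_iff (two_ne_zero) |>.1 (le_antisymm h2 (sq_nonneg _))
  exact min_eq_right_iff.1 h3

/-- Once `D ≥ 0` is known, `exp (K x) D` is nondecreasing; ending at `0` forces `D ≤ 0`. This turns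
weak comparison into strict comparison. -/
theorem eq_zero_of_right (hD : HasACDeriv D D' a b)
    (h : ∀ᵐ x, x ∈ Icc a b → -(K * |D x|) ≤ D' x)
    (ha : 0 ≤ D a) (hb : D b = 0) : ∀ x ∈ Icc a b, D x = 0 := by
  intro x hx
  have hab := hx.1.trans hx.2
  have h0 := hD.nonneg h ha
  have hm := (hD.exp_mul hab K).monotoneOn (by
    filter_upwards [h] with t ht hx
    have := ht hx
    rw [abs_of_nonneg (h0 t hx)] at this
    exact mul_nonneg (Real.exp_pos _).le (by linarith)) hx (right_mem_Icc.2 hab) hx.2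
  simp only [hb, mul_zero] at hm
  exact le_antisymm (nonpos_of_mul_nonpos_right hm (Real.exp_pos _)) (h0 x hx)

end HasACDeriv

/-! ### The Prüfer equation: comparison and bounds -/

/-- The right-hand side of the Prüfer equation for `-f'' = q f`. -/
def pruferField (q θ : ℝ) : ℝ := Real.cos θ ^ 2 + q * Real.sin θ ^ 2

theorem pruferField_eq (q θ : ℝ) : pruferField q θ = 1 + (q - 1) * Real.sin θ ^ 2 := by
  rw [pruferField, Real.cos_sq']
  ring

theorem abs_sin_sq_sub_le (x y : ℝ) : |Real.sin x ^ 2 - Real.sin y ^ 2| ≤ 2 * |x - y| := by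
  have h1 : |Real.sin x - Real.sin y| ≤ |x - y| := by
    simpa [Real.dist_eq] using Real.lipschitzWith_sin.dist_le_mul x y
  have h2 : |Real.sin x + Real.sin y| ≤ 2 := by
    refine (abs_add_le _ _).trans ?_
    linarith [Real.abs_sin_le_one x, Real.abs_sin_le_one y]
  rw [sq_sub_sq, abs_mul]
  exact mul_le_mul h2 h1 (abs_nonneg _) (by norm_num)

theorem abs_pruferField_sub_le {q K : ℝ} (hq : |q| ≤ K) (x y : ℝ) :
    |pruferField q x - pruferField q y| ≤ 2 * (K + 1) * |x - y| := by
  rw [pruferField_eq, pruferField_eq, add_sub_add_left_eq_sub, ← mul_sub, abs_mul]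
  have h1 : |q - 1| ≤ K + 1 := (abs_sub _ _).trans (by simpa using hq)
  have := mul_le_mul h1 (abs_sin_sq_sub_le x y) (abs_nonneg _) ((abs_nonneg _).trans h1)
  linarith

theorem abs_pruferField_le {q K : ℝ} (hq : |q| ≤ K) (x : ℝ) : |pruferField q x| ≤ K + 1 := by
  have h1 := Real.sin_sq_le_one x
  have h2 := Real.cos_sq_le_one x
  have h3 := abs_le.1 hq
  rw [pruferField, abs_le]
  constructor <;> nlinarith [sq_nonneg (Real.sin x), sq_nonneg (Real.cos x)]

theorem measurable_pruferField_comp {q u : ℝ → ℝ} (hq : AEMeasurable q volume)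
    (hu : Measurable u) : AEMeasurable (fun t => pruferField (q t) (u t)) volume := by
  unfold pruferField
  fun_prop

/-- `θ` is a Prüfer angle on `[a, b]` for the equation `-f'' = q f`. -/
def IsPruferAngle (q θ : ℝ → ℝ) (a b : ℝ) : Prop :=
  HasACDeriv θ (fun x => pruferField (q x) (θ x)) a b

theorem sub_pruferField_ge {q₁ q₂ K x y : ℝ} (hq : |q₂| ≤ K) :
    (q₂ - q₁) * Real.sin x ^ 2 - 2 * (K + 1) * |y - x| ≤ pruferField q₂ y - pruferField q₁ x := by
  have := (abs_le.1 (abs_pruferField_sub_le hq y x)).1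
  have h2 : pruferField q₂ x - pruferField q₁ x = (q₂ - q₁) * Real.sin x ^ 2 := by
    rw [pruferField_eq, pruferField_eq]
    ring
  linarith

theorem exists_mem_Ioo_of_ae {p : ℝ → Prop} (hab : a < b) (h : ∀ᵐ x, p x) :
    ∃ x ∈ Ioo a b, p x := by
  by_contra! hc
  have h1 : Ioo a b ⊆ {x | ¬ p x} := fun x hx => hc x hx
  have h2 := measure_mono_null h1 (ae_iff.1 h)
  simp [hab.not_ge] at h2

namespace IsPruferAngle

variable {q₁ q₂ θ₁ θ₂ q θ : ℝ → ℝ} {a b K : ℝ}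

/-- The field increases with `q` and is Lipschitz in the angle, so the difference of two angles
satisfies the differential inequality of `HasACDeriv.nonneg`. -/
theorem sub_ge (hq₂ : ∀ x, |q₂ x| ≤ K) (hq : ∀ᵐ x, q₁ x ≤ q₂ x) :
    ∀ᵐ x, x ∈ Icc a b → -(2 * (K + 1) * |θ₂ x - θ₁ x|) ≤
      pruferField (q₂ x) (θ₂ x) - pruferField (q₁ x) (θ₁ x) := by
  filter_upwards [hq] with x hx _
  have := sub_pruferField_ge (q₁ := q₁ x) (x := θ₁ x) (y := θ₂ x) (hq₂ x)
  have h2 := mul_nonneg (sub_nonneg.2 hx) (sq_nonneg (Real.sin (θ₁ x)))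
  linarith

theorem le (h₁ : IsPruferAngle q₁ θ₁ a b) (h₂ : IsPruferAngle q₂ θ₂ a b)
    (hq₂ : ∀ x, |q₂ x| ≤ K) (hq : ∀ᵐ x, q₁ x ≤ q₂ x) (ha : θ₁ a ≤ θ₂ a) :
    ∀ x ∈ Icc a b, θ₁ x ≤ θ₂ x := fun x hx =>
  sub_nonneg.1 ((HasACDeriv.sub h₂ h₁).nonneg (sub_ge hq₂ hq) (sub_nonneg.2 ha) x hx)

/-- The sine of a Prüfer angle does not vanish almost everywhere. -/
theorem not_sin_eq_zero (h : IsPruferAngle q θ a b) (hab : a < b)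
    (h0 : ∀ᵐ x, x ∈ Icc a b → Real.sin (θ x) = 0) : False := by
  have hc : ∀ x ∈ Icc a b, Real.sin (θ x) = 0 := fun x hx =>
    Measure.eqOn_Icc_of_ae_eq volume hab.ne (f := fun x => Real.sin (θ x)) (g := fun _ => 0)
      (by rw [EventuallyEq, ae_restrict_iff' measurableSet_Icc]; exact h0)
      (Real.continuous_sin.comp_continuousOn (HasACDeriv.continuousOn h)) continuousOn_const hx
  obtain ⟨x, hx, hd⟩ := exists_mem_Ioo_of_ae hab h.deriv
  have hxI := Ioo_subset_Icc_self hx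
  have h1 := (hd hxI).sin
  have h2 : HasDerivAt (fun x => Real.sin (θ x)) 0 x := by
    refine (hasDerivAt_const x (0 : ℝ)).congr_of_eventuallyEq ?_
    filter_upwards [Icc_mem_nhds hx.1 hx.2] with y hy using hc y hy
  -- Where `sin θ = 0` the field equals `1`, so the derivative of `sin θ` is `cos θ ≠ 0`.
  have h3 := h1.unique h2
  have h4 := Real.sin_sq_add_cos_sq (θ x)
  rw [hc x hxI] at h4
  rw [pruferField_eq, hc x hxI] at h3
  norm_num at h3
  rw [h3] at h4
  norm_num at h4

/-- Equality at `b` would make the angles agree on all of `[a, b]`. Subtracting the two equations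
then gives `(E₂ - E₁) sin² θ₁ = 0` almost everywhere, which is impossible. -/
theorem lt_right {E₁ E₂ : ℝ} {V : ℝ → ℝ} (hE : E₁ < E₂) (hab : a < b)
    (h₁ : IsPruferAngle (fun x => E₁ - V x) θ₁ a b)
    (h₂ : IsPruferAngle (fun x => E₂ - V x) θ₂ a b)
    (hq₂ : ∀ x, |E₂ - V x| ≤ K) (ha : θ₁ a = θ₂ a) : θ₁ b < θ₂ b := by
  have hq : ∀ᵐ x, E₁ - V x ≤ E₂ - V x := Eventually.of_forall fun x => by linarith
  refine lt_of_le_of_ne (h₁.le h₂ hq₂ hq ha.le b (right_mem_Icc.2 hab.le)) fun hb => ?_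
  have hD := HasACDeriv.sub h₂ h₁
  have hz := hD.eq_zero_of_right (sub_ge hq₂ hq) (by simp [ha]) (by simp [hb])
  refine h₁.not_sin_eq_zero hab ?_
  filter_upwards [hD.deriv, ae_mem_Ioo_of_mem_Icc a b] with x hx hI hxI
  have h2 : HasDerivAt (fun x => θ₂ x - θ₁ x) 0 x := by
    refine (hasDerivAt_const x (0 : ℝ)).congr_of_eventuallyEq ?_
    filter_upwards [Icc_mem_nhds (hI hxI).1 (hI hxI).2] with y hy using hz y hy
  have h3 := (hx hxI).unique h2
  rw [sub_eq_zero.1 (hz x hxI), pruferField_eq, pruferField_eq] at h3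
  have h4 : (E₂ - E₁) * Real.sin (θ₁ x) ^ 2 = 0 := by linarith
  simpa [sub_ne_zero.2 hE.ne'] using h4

/-- A Gronwall estimate, used for continuity of the phase in `E`: the difference `D` satisfies `D' ≤
(E₂ - E₁) + M D`, and the right-hand side of the bound, as a function of its end point, is a
supersolution. -/
theorem sub_le {E₁ E₂ : ℝ} {V : ℝ → ℝ} (hE : E₁ ≤ E₂) (hab : a ≤ b)
    (h₁ : IsPruferAngle (fun x => E₁ - V x) θ₁ a b)
    (h₂ : IsPruferAngle (fun x => E₂ - V x) θ₂ a b)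
    (hq₂ : ∀ x, |E₂ - V x| ≤ K) (ha : θ₁ a = θ₂ a) :
    θ₂ b - θ₁ b ≤ (E₂ - E₁) * (b - a) * Real.exp (2 * (K + 1) * (b - a)) := by
  set M := 2 * (K + 1) with hM
  have hq : ∀ᵐ x, E₁ - V x ≤ E₂ - V x := Eventually.of_forall fun x => by linarith
  have hle := h₁.le h₂ hq₂ hq ha.le
  have hK : 0 ≤ K := (abs_nonneg _).trans (hq₂ 0)
  have hP : HasACDeriv (fun x => (E₂ - E₁) * (x - a) * Real.exp (M * (x - a)))
      (fun x => (E₂ - E₁) * (1 + M * (x - a)) * Real.exp (M * (x - a))) a b := by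
    refine HasACDeriv.of_hasDerivAt hab (fun x => ?_) (by fun_prop)
    have h1 : HasDerivAt (fun x => x - a) 1 x := (hasDerivAt_id x).sub_const a
    refine ((h1.const_mul (E₂ - E₁)).mul (h1.const_mul M).exp).congr_deriv ?_
    ring
  have := (hP.sub (HasACDeriv.sub h₂ h₁)).nonneg (K := M) (by
    refine Eventually.of_forall fun x hx => ?_
    have h1 := (abs_le.1 (abs_pruferField_sub_le (hq₂ x) (θ₂ x) (θ₁ x))).2
    rw [abs_of_nonneg (sub_nonneg.2 (hle x hx)), ← hM] at h1
    have h2 : pruferField (E₂ - V x) (θ₁ x) - pruferField (E₁ - V x) (θ₁ x) ≤ E₂ - E₁ := by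
      rw [pruferField_eq, pruferField_eq]
      nlinarith [Real.sin_sq_le_one (θ₁ x)]
    have h3 : 1 ≤ Real.exp (M * (x - a)) :=
      Real.one_le_exp (mul_nonneg (by positivity) (sub_nonneg.2 hx.1))
    have h4 := neg_abs_le ((E₂ - E₁) * (x - a) * Real.exp (M * (x - a)) - (θ₂ x - θ₁ x))
    have h5 : 0 ≤ M := by positivity
    have h6 := mul_le_mul_of_nonneg_left h3 (sub_nonneg.2 hE)
    have h7 := mul_le_mul_of_nonneg_left (le_abs_self
      (-((E₂ - E₁) * (x - a) * Real.exp (M * (x - a)) - (θ₂ x - θ₁ x)))) h5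
    rw [abs_neg] at h7
    have h8 := mul_le_mul_of_nonneg_left h4 h5
    nlinarith) (by simp [ha]) b (right_mem_Icc.2 hab)
  simpa using this

/-- The field is `1` at angle `0`, so by the Lipschitz bound `θ' ≥ -2 (K + 1) |θ|`; returning to `0`
at `b` would force `θ = 0` throughout. -/
theorem right_pos (h : IsPruferAngle q θ a b) (hab : a < b) (hq : ∀ x, |q x| ≤ K)
    (ha : θ a = 0) : 0 < θ b := by
  have hge : ∀ᵐ x, x ∈ Icc a b → -(2 * (K + 1) * |θ x|) ≤ pruferField (q x) (θ x) := by
    refine Eventually.of_forall fun x _ => ?_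
    have := (abs_le.1 (abs_pruferField_sub_le (hq x) (θ x) 0)).1
    simp only [pruferField_eq, Real.sin_zero, sub_zero] at this ⊢
    linarith
  refine lt_of_le_of_ne (HasACDeriv.nonneg h hge ha.ge b (right_mem_Icc.2 hab.le)) fun hb => ?_
  have hz := HasACDeriv.eq_zero_of_right h hge ha.ge hb.symm
  exact h.not_sin_eq_zero hab (Eventually.of_forall fun x hx => by simp [hz x hx])

theorem right_le_pi_div_four (h : IsPruferAngle q θ a b) (hab : a ≤ b) (hq : ∀ x, q x ≤ -1)
    (ha : θ a = 0) : θ b ≤ Real.pi / 4 := by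
  -- The constant `π / 4` is an equilibrium for `q = -1`, since `cos² = sin²` there, and serves as a
  -- barrier.
  have h2 : IsPruferAngle (fun _ => -1) (fun _ => Real.pi / 4) a b := by
    have : pruferField (-1) (Real.pi / 4) = 0 := by simp [pruferField]
    simp only [IsPruferAngle, this]
    exact HasACDeriv.of_hasDerivAt hab (fun x => hasDerivAt_const x _) continuous_const
  exact h.le h2 (K := 1) (by simp) (Eventually.of_forall hq) (by rw [ha]; positivity) b
    (right_mem_Icc.2 hab)

theorem right_le_mul {Q : ℝ} (h : IsPruferAngle q θ a b) (hab : a ≤ b) (hQ : 1 ≤ Q)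
    (hq : ∀ x, q x ≤ Q) (ha : θ a = 0) : θ b ≤ Q * (b - a) := by
  have hP : HasACDeriv (fun x => Q * (x - a)) (fun _ => Q) a b := by
    refine HasACDeriv.of_hasDerivAt hab (fun x => ?_) (by fun_prop)
    simpa using ((hasDerivAt_id x).sub_const a).const_mul Q
  have := (hP.sub h).monotoneOn (Eventually.of_forall fun x _ => by
    rw [pruferField_eq]
    nlinarith [Real.sin_sq_le_one (θ x), sq_nonneg (Real.sin (θ x)), hq x])
    (left_mem_Icc.2 hab) (right_mem_Icc.2 hab) hab
  simp only [ha, sub_self, mul_zero] at this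
  linarith

/-- Separation of variables: the primitive of `(1 + M sin² φ)⁻¹`, evaluated at `θ`, grows at rate at
least `1`. -/
theorem sub_le_integral {M : ℝ} (hM : 0 ≤ M) (h : IsPruferAngle q θ a b) (hab : a ≤ b)
    (hq : ∀ x, 1 + M ≤ q x) (ha : θ a = 0) :
    b - a ≤ ∫ φ in 0..θ b, (1 + M * Real.sin φ ^ 2)⁻¹ := by
  have hpos : ∀ φ, 0 < 1 + M * Real.sin φ ^ 2 := fun φ => by positivity
  have hc : Continuous fun φ => (1 + M * Real.sin φ ^ 2)⁻¹ :=
    Continuous.inv₀ (by fun_prop) fun φ => (hpos φ).ne'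
  have hG := HasACDeriv.comp (φ := fun x => ∫ φ in (0 : ℝ)..x, (1 + M * Real.sin φ ^ 2)⁻¹)
    (fun x => intervalIntegral.integral_hasDerivAt_right (hc.intervalIntegrable _ _)
      (hc.stronglyMeasurableAtFilter _ _) hc.continuousAt) hc h
  have hx : HasACDeriv (fun x : ℝ => x) (fun _ => 1) a b :=
    HasACDeriv.of_hasDerivAt hab hasDerivAt_id continuous_const
  have := (hG.sub hx).monotoneOn (Eventually.of_forall fun x _ => by
    rw [sub_nonneg, ← div_eq_inv_mul, one_le_div (hpos _), pruferField_eq]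
    nlinarith [sq_nonneg (Real.sin (θ x)), hq x])
    (left_mem_Icc.2 hab) (right_mem_Icc.2 hab) hab
  simp only [ha, intervalIntegral.integral_same] at this
  linarith

end IsPruferAngle

/-- By dominated convergence, the time needed to reach any angle `c` tends to `0` at high energy;
this makes the phase unbounded. -/
theorem tendsto_integral_inv_one_add_mul_sin_sq (c : ℝ) :
    Tendsto (fun n : ℕ => ∫ φ in 0..c, (1 + (n : ℝ) * Real.sin φ ^ 2)⁻¹) atTop (𝓝 0) := by
  have hz : ∀ᵐ φ : ℝ, Real.sin φ ≠ 0 := by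
    have : {φ : ℝ | ¬ Real.sin φ ≠ 0} ⊆ range fun n : ℤ => (n : ℝ) * Real.pi := by
      intro φ hφ
      simpa [Real.sin_eq_zero_iff] using hφ
    exact measure_mono_null this ((countable_range _).measure_zero _)
  have := intervalIntegral.tendsto_integral_filter_of_dominated_convergence (μ := volume)
    (a := 0) (b := c) (l := atTop) (F := fun (n : ℕ) φ => (1 + (n : ℝ) * Real.sin φ ^ 2)⁻¹)
    (f := fun _ => 0) (fun _ => 1) ?_ ?_ (by simp) ?_
  · simpa using this
  · exact Eventually.of_forall fun n => Measurable.aestronglyMeasurable (by fun_prop)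
  · refine Eventually.of_forall fun n => Eventually.of_forall fun φ _ => ?_
    rw [Real.norm_eq_abs, abs_of_nonneg (by positivity)]
    exact inv_le_one_of_one_le₀ (by nlinarith [mul_nonneg n.cast_nonneg (sq_nonneg (Real.sin φ))])
  · filter_upwards [hz] with φ hφ _
    refine Tendsto.comp tendsto_inv_atTop_zero (tendsto_atTop_add_const_left _ _ ?_)
    exact tendsto_natCast_atTop_atTop.atTop_mul_const (by positivity)

/-! ### Existence of the Prüfer angle and amplitude -/

theorem intervalIntegrable_pruferField {q u : ℝ → ℝ} {K : ℝ} (hq : AEMeasurable q volume)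
    (hK : ∀ x, |q x| ≤ K) (hu : Measurable u) (c d : ℝ) :
    IntervalIntegrable (fun t => pruferField (q t) (u t)) volume c d := by
  refine (intervalIntegrable_const (c := K + 1)).mono_fun
    (measurable_pruferField_comp hq hu).aestronglyMeasurable.restrict ?_
  refine Eventually.of_forall fun t => ?_
  exact (abs_pruferField_le (hK t) _).trans (le_abs_self _)

/-- A Prüfer angle exists for every bounded measurable coefficient. -/
theorem exists_isPruferAngle {q : ℝ → ℝ} {a b K : ℝ} (hab : a < b) (hq : AEMeasurable q volume)
    (hK : ∀ x, |q x| ≤ K) : ∃ θ : ℝ → ℝ, Continuous θ ∧ θ a = 0 ∧ IsPruferAngle q θ a b := by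
  have hK0 : 0 ≤ K := (abs_nonneg _).trans (hK 0)
  set L := 2 * (K + 1) with hL
  have hL0 : 0 < L := by positivity
  -- The fixed-point unknown is `u = exp (-M t) θ`. In this weighted sup metric the Picard map has
  -- constant `L / M = 1 / 2` on the whole interval, so no subdivision is needed.
  set M := 2 * L with hM
  have hM0 : 0 < M := by positivity
  let w : C(Icc a b, ℝ) → ℝ → ℝ := fun u t => Real.exp (M * t) * IccExtend hab.le u t
  have hw : ∀ u, Continuous (w u) := fun u =>
    Continuous.mul (by fun_prop) u.continuous.Icc_extend'
  have hi : ∀ u c d, IntervalIntegrable (fun t => pruferField (q t) (w u t)) volume c d :=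
    fun u c d => intervalIntegrable_pruferField hq hK (hw u).measurable c d
  let S : C(Icc a b, ℝ) → ℝ → ℝ := fun u x => ∫ t in a..x, pruferField (q t) (w u t)
  have hS : ∀ u, Continuous (S u) := fun u =>
    intervalIntegral.continuous_primitive (hi u) a
  let T : C(Icc a b, ℝ) → C(Icc a b, ℝ) := fun u =>
    ⟨fun x => Real.exp (-(M * x)) * S u x,
      Continuous.mul (by fun_prop) ((hS u).comp continuous_subtype_val)⟩
  have hT : ContractingWith (1 / 2) T := by
    refine ⟨by norm_num, LipschitzWith.of_dist_le_mul fun u v => ?_⟩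
    rw [ContinuousMap.dist_le (by positivity)]
    rintro ⟨x, hx⟩
    have h1 : |S u x - S v x| ≤ ∫ t in a..x, L * (Real.exp (M * t) * dist u v) := by
      rw [← Real.norm_eq_abs]
      simp only [S]
      rw [← intervalIntegral.integral_sub (hi u _ _) (hi v _ _)]
      refine intervalIntegral.norm_integral_le_of_norm_le hx.1
        (Eventually.of_forall fun t _ => ?_) (Continuous.intervalIntegrable (by fun_prop) _ _)
      refine (abs_pruferField_sub_le (hK t) _ _).trans ?_
      refine mul_le_mul_of_nonneg_left ?_ hL0.le
      simp only [w]
      rw [← mul_sub, abs_mul, abs_of_pos (Real.exp_pos _)]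
      exact mul_le_mul_of_nonneg_left (ContinuousMap.dist_apply_le_dist (f := u) (g := v)
        (projIcc a b hab.le t)) (Real.exp_pos _).le
    have h2 : ∫ t in a..x, L * (Real.exp (M * t) * dist u v) =
        (Real.exp (M * x) - Real.exp (M * a)) * (1 / 2) * dist u v := by
      rw [intervalIntegral.integral_const_mul, intervalIntegral.integral_mul_const,
        intervalIntegral.integral_comp_mul_left Real.exp hM0.ne', integral_exp, smul_eq_mul, hM]
      field_simp
    change |Real.exp (-(M * x)) * S u x - Real.exp (-(M * x)) * S v x| ≤ _
    rw [← mul_sub, abs_mul, abs_of_pos (Real.exp_pos _)]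
    rw [h2] at h1
    calc _ ≤ Real.exp (-(M * x)) * (Real.exp (M * x) * (1 / 2) * dist u v) := by
          refine mul_le_mul_of_nonneg_left (h1.trans ?_) (Real.exp_pos _).le
          have := Real.exp_pos (M * a)
          gcongr
          linarith
      _ = _ := by
          rw [← mul_assoc, ← mul_assoc, ← Real.exp_add]
          simp
  set u := ContractingWith.fixedPoint T hT with hu
  have hfix : T u = u := hT.fixedPoint_isFixedPt
  have hval : ∀ x ∈ Icc a b, w u x = S u x := by
    intro x hx
    have : IccExtend hab.le u x = Real.exp (-(M * x)) * S u x := by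
      rw [IccExtend_of_mem _ _ hx]
      exact (DFunLike.congr_fun hfix ⟨x, hx⟩).symm
    simp only [w]
    rw [this, ← mul_assoc, ← Real.exp_add]
    simp
  have h0 : w u a = 0 := by rw [hval a (left_mem_Icc.2 hab.le)]; simp [S]
  refine ⟨w u, hw u, h0, HasACDeriv.of_integral hab.le (hi u a b) fun x hx => ?_⟩
  rw [h0, zero_add]
  exact hval x hx

/-- The logarithm of the Prüfer amplitude. -/
theorem exists_pruferLogAmplitude {q θ : ℝ → ℝ} {a b K : ℝ} (hab : a ≤ b)
    (hq : AEMeasurable q volume) (hK : ∀ x, |q x| ≤ K) (hθ : Continuous θ) :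
    ∃ R : ℝ → ℝ, Continuous R ∧ R a = 0 ∧
      HasACDeriv R (fun x => (1 - q x) * Real.sin (θ x) * Real.cos (θ x)) a b := by
  have hi : ∀ c d, IntervalIntegrable (fun x => (1 - q x) * Real.sin (θ x) * Real.cos (θ x))
      volume c d := by
    intro c d
    have hm : AEMeasurable (fun x => (1 - q x) * Real.sin (θ x) * Real.cos (θ x)) volume := by
      have := hθ.measurable
      fun_prop
    refine (intervalIntegrable_const (c := 1 + K)).mono_fun hm.aestronglyMeasurable.restrict ?_
    refine Eventually.of_forall fun t => ?_
    have h1 : |1 - q t| ≤ 1 + K := (abs_sub _ _).trans (by simpa using hK t)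
    simp only [Real.norm_eq_abs, abs_mul]
    refine le_trans ?_ (le_abs_self _)
    refine (mul_le_of_le_one_right (by positivity) (Real.abs_cos_le_one _)).trans ?_
    exact (mul_le_of_le_one_right (by positivity) (Real.abs_sin_le_one _)).trans h1
  refine ⟨fun x => ∫ t in a..x, (1 - q t) * Real.sin (θ t) * Real.cos (θ t),
    intervalIntegral.continuous_primitive hi a, by simp,
    HasACDeriv.of_integral hab (hi a b) (by simp)⟩

/-! ### Prüfer variables and eigenfunctions -/

namespace IsPruferAngle

variable {q θ R : ℝ → ℝ} {a b : ℝ}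

theorem sin (h : IsPruferAngle q θ a b) : HasACDeriv (fun x => Real.sin (θ x))
    (fun x => Real.cos (θ x) * pruferField (q x) (θ x)) a b :=
  HasACDeriv.comp Real.hasDerivAt_sin Real.continuous_cos h

theorem cos (h : IsPruferAngle q θ a b) : HasACDeriv (fun x => Real.cos (θ x))
    (fun x => -Real.sin (θ x) * pruferField (q x) (θ x)) a b :=
  HasACDeriv.comp Real.hasDerivAt_cos (by fun_prop) h

/-- The equations for `θ` and `R` make `exp R (sin θ, cos θ)` the pair formed by a solution of `-y''
= q y` and its derivative; this is the first half, `exp_mul_cos` the second. -/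
theorem exp_mul_sin (h : IsPruferAngle q θ a b)
    (hR : HasACDeriv R (fun x => (1 - q x) * Real.sin (θ x) * Real.cos (θ x)) a b) :
    HasACDeriv (fun x => Real.exp (R x) * Real.sin (θ x))
      (fun x => Real.exp (R x) * Real.cos (θ x)) a b := by
  refine ((hR.comp Real.hasDerivAt_exp Real.continuous_exp).mul h.sin).congr_deriv
    (Eventually.of_forall fun x _ => ?_)
  rw [pruferField]
  linear_combination Real.exp (R x) * Real.cos (θ x) * Real.sin_sq_add_cos_sq (θ x)

theorem exp_mul_cos (h : IsPruferAngle q θ a b)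
    (hR : HasACDeriv R (fun x => (1 - q x) * Real.sin (θ x) * Real.cos (θ x)) a b) :
    HasACDeriv (fun x => Real.exp (R x) * Real.cos (θ x))
      (fun x => -q x * (Real.exp (R x) * Real.sin (θ x))) a b := by
  refine ((hR.comp Real.hasDerivAt_exp Real.continuous_exp).mul h.cos).congr_deriv
    (Eventually.of_forall fun x _ => ?_)
  rw [pruferField]
  linear_combination -q x * Real.exp (R x) * Real.sin (θ x) * Real.sin_sq_add_cos_sq (θ x)

/-- A solution of `-f'' = q f` with `f a = f b = 0` vanishes identically, unless `sin (θ b) = 0`. -/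
theorem solution_eq_zero {f f' w : ℝ → ℂ} (h : IsPruferAngle q θ a b) (hab : a ≤ b)
    (hR : HasACDeriv R (fun x => (1 - q x) * Real.sin (θ x) * Real.cos (θ x)) a b)
    (hf : HasACDeriv f f' a b) (hf' : HasACDeriv f' w a b)
    (hw : ∀ᵐ x, x ∈ Icc a b → w x = -(q x : ℂ) * f x) (hθa : θ a = 0)
    (ha : f a = 0) (hb : f b = 0) (hs : Real.sin (θ b) ≠ 0) : ∀ x ∈ Icc a b, f x = 0 := by
  have haI := left_mem_Icc.2 hab
  have hbI := right_mem_Icc.2 hab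
  -- The Wronskian of `f` and `exp R sin θ` is constant, and zero at `a`; hence `(f, f')` is
  -- parallel to `(sin θ, cos θ)`.
  have hB0 := (((h.exp_mul_cos hR).smul hf).sub ((h.exp_mul_sin hR).smul hf')).eq_left (by
    filter_upwards [hw] with x hx hxI
    rw [hx hxI]
    simp only [Complex.real_smul]
    push_cast
    ring)
  have hB : ∀ x ∈ Icc a b, (Real.cos (θ x) : ℂ) * f x = Real.sin (θ x) * f' x := by
    intro x hx
    have h1 := hB0 x hx
    simp only [ha, hθa, Complex.real_smul, Real.sin_zero, mul_zero, Complex.ofReal_zero, zero_mul,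
      sub_zero, Complex.ofReal_mul] at h1
    have h2 : (Real.exp (R x) : ℂ) ≠ 0 := by exact_mod_cast (Real.exp_pos _).ne'
    refine mul_left_cancel₀ h2 ?_
    linear_combination h1
  have hρ : HasACDeriv (fun x => Real.exp (-R x))
      (fun x => -Real.exp (-R x) * ((1 - q x) * Real.sin (θ x) * Real.cos (θ x))) a b :=
    HasACDeriv.comp (φ := fun t => Real.exp (-t)) (fun t => by
      simpa using (hasDerivAt_neg t).exp) (by fun_prop) hR
  -- Given that parallelism, the factor of proportionality divided by the amplitude `exp R` is also
  -- constant. At `b` it is zero, because `f b = 0` and `sin (θ b) ≠ 0` force `f' b = 0`.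
  have hA := (((hρ.mul h.sin).smul hf).add ((hρ.mul h.cos).smul hf')).eq_left (by
    filter_upwards [hw] with x hx hxI
    rw [hx hxI]
    have h1 := hB x hxI
    have h2 : (Real.sin (θ x) : ℂ) ^ 2 + (Real.cos (θ x) : ℂ) ^ 2 = 1 := by
      exact_mod_cast Real.sin_sq_add_cos_sq (θ x)
    simp only [Complex.real_smul, pruferField, Complex.ofReal_mul, Complex.ofReal_add,
      Complex.ofReal_sub, Complex.ofReal_neg, Complex.ofReal_pow, Complex.ofReal_one]
    generalize (Real.sin (θ x) : ℂ) = s at *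
    generalize (Real.cos (θ x) : ℂ) = c at *
    generalize (Real.exp (-R x) : ℂ) = ρ at *
    linear_combination ρ * (1 - q x) * (c ^ 2 - s ^ 2) * h1 +
      (ρ * f x * c * q x - ρ * s * f' x) * h2)
  have hf'b : f' b = 0 := by
    have h1 := hB b hbI
    rw [hb, mul_zero] at h1
    exact (mul_eq_zero.1 h1.symm).resolve_left (by exact_mod_cast hs)
  have hAb := hA b hbI
  simp only [hb, hf'b, smul_zero, add_zero] at hAb
  intro x hx
  have h1 := (hA x hx).trans hAb.symm
  simp only [Complex.real_smul, Complex.ofReal_mul] at h1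
  have h2 : (Real.exp (-R x) : ℂ) ≠ 0 := by exact_mod_cast (Real.exp_pos _).ne'
  have h3 : (Real.sin (θ x) : ℂ) * f x + Real.cos (θ x) * f' x = 0 := by
    refine mul_left_cancel₀ h2 ?_
    linear_combination h1
  have h4 : (Real.sin (θ x) : ℂ) ^ 2 + (Real.cos (θ x) : ℂ) ^ 2 = 1 := by
    exact_mod_cast Real.sin_sq_add_cos_sq (θ x)
  linear_combination -f x * h4 + Real.sin (θ x) * h3 + Real.cos (θ x) * hB x hx

end IsPruferAngle

theorem mem_eigenvalues {V : ℝ → ℝ} {a b E : ℝ} : E ∈ eigenvalues V a b ↔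
    ∃ u : L2 a b, u ≠ 0 ∧ (u, (E : ℂ) • u) ∈ hamiltonianGraph V a b := by
  rw [← hamiltonian_graph]
  constructor
  · rintro ⟨u, hu, h⟩
    exact ⟨u, hu, by rw [← h]; exact LinearPMap.mem_graph _ u⟩
  · rintro ⟨u, hu, h⟩
    obtain ⟨y, hy, hy'⟩ := (LinearPMap.mem_graph_iff _).1 h
    exact ⟨y, by simpa [hy] using hu, by simpa [hy] using hy'⟩

/-- If `sin (θ b) = 0`, then `exp R sin θ` is an eigenfunction; otherwise `solution_eq_zero` rules
out every candidate. -/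
theorem mem_eigenvalues_iff_sin {V θ : ℝ → ℝ} {a b E K : ℝ} (hab : a < b)
    (hV : AEMeasurable V volume) (hK : ∀ x, |V x| ≤ K) (hθ : Continuous θ) (hθa : θ a = 0)
    (h : IsPruferAngle (fun x => E - V x) θ a b) :
    E ∈ eigenvalues V a b ↔ Real.sin (θ b) = 0 := by
  have hqK : ∀ x, |E - V x| ≤ |E| + K := fun x => (abs_sub _ _).trans (by linarith [hK x])
  obtain ⟨R, hRc, hRa, hR⟩ :=
    exists_pruferLogAmplitude hab.le (hV.const_sub E) hqK hθ
  have ha := left_mem_Icc.2 hab.le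
  have hb := right_mem_Icc.2 hab.le
  rw [mem_eigenvalues]
  constructor
  · rintro ⟨u, hu, f, f', w, hf, h1, h2⟩
    by_contra hs
    have hfd : HasACDeriv f f' a b :=
      HasACDeriv.of_integral hab.le (hf.intervalIntegrable_deriv ha hb) hf.eq_integral
    have hfd' : HasACDeriv f' w a b :=
      HasACDeriv.of_integral hab.le (intervalIntegrable_L2 w ha hb) hf.deriv_eq_integral
    have hw : ∀ᵐ x, x ∈ Icc a b → w x = -((E - V x : ℝ) : ℂ) * f x := by
      have h3 := Lp.coeFn_smul (E : ℂ) u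
      rw [EventuallyEq, ae_restrict_iff' measurableSet_Icc] at h1 h2 h3
      filter_upwards [h1, h2, h3] with x h1 h2 h3 hx
      have h4 := (h2 hx).symm.trans (h3 hx)
      simp only [Pi.smul_apply, smul_eq_mul] at h4 h1
      rw [h1 hx] at h4
      push_cast
      linear_combination -h4
    have hz := h.solution_eq_zero hab.le hR hfd hfd' hw hθa hf.left hf.right hs
    refine hu (Lp.ext ?_)
    refine h1.trans (EventuallyEq.trans ?_ (Lp.coeFn_zero ℂ 2 _).symm)
    rw [EventuallyEq, ae_restrict_iff' measurableSet_Icc]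
    exact Eventually.of_forall fun x hx => by simp [hz x hx]
  · intro hs
    set y : ℝ → ℝ := fun x => Real.exp (R x) * Real.sin (θ x) with hy
    set z : ℝ → ℝ := fun x => Real.exp (R x) * Real.cos (θ x) with hz
    have hyc : Continuous y := by fun_prop
    have hzc : Continuous z := by fun_prop
    have hyd : HasACDeriv y z a b := h.exp_mul_sin hR
    have hzd : HasACDeriv z (fun x => -(E - V x) * y x) a b := h.exp_mul_cos hR
    obtain ⟨C, hC⟩ := isCompact_Icc.exists_bound_of_continuousOn (s := Icc a b) hyc.continuousOn
    have hmem : MemLp (fun x => (y x : ℂ)) 2 (volume.restrict (Icc a b)) := by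
      refine MemLp.of_bound (by fun_prop) C ?_
      rw [ae_restrict_iff' measurableSet_Icc]
      exact Eventually.of_forall fun x hx => by simpa using hC x hx
    have hwmem : MemLp (fun x => ((-(E - V x) * y x : ℝ) : ℂ)) 2 (volume.restrict (Icc a b)) := by
      refine MemLp.of_bound ?_ ((|E| + K) * C) ?_
      · have hm : AEMeasurable (fun x => ((-(E - V x) * y x : ℝ) : ℂ)) volume :=
          Complex.measurable_ofReal.comp_aemeasurable (by fun_prop)
        exact hm.aestronglyMeasurable.restrict
      · rw [ae_restrict_iff' measurableSet_Icc]
        refine Eventually.of_forall fun x hx => ?_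
        rw [Complex.norm_real, norm_mul, norm_neg]
        exact mul_le_mul (hqK x) (hC x hx) (norm_nonneg _) ((abs_nonneg _).trans (hqK x))
    have hw := hwmem.coeFn_toLp
    have hu := hmem.coeFn_toLp
    have hwi := intervalIntegrable_L2 (hwmem.toLp _) ha hb
    have hwi' : IntervalIntegrable (fun x => -(E - V x) * y x) volume a b := by
      have : IntegrableOn (fun x => ((-(E - V x) * y x : ℝ) : ℂ)) (Icc a b) volume :=
        hwmem.integrable (by norm_num)
      have h2 : IntegrableOn (fun x => -(E - V x) * y x) (Icc a b) volume := by
        simpa [IntegrableOn] using this.re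
      exact (intervalIntegrable_iff_integrableOn_Icc_of_le hab.le).2 h2
    refine ⟨hmem.toLp _, fun h0 => ?_, fun x => y x, fun x => z x, hwmem.toLp _, ?_, hu, ?_⟩
    · refine h.not_sin_eq_zero hab ?_
      rw [h0] at hu
      have h1 := hu.symm.trans (Lp.coeFn_zero ℂ 2 _)
      rw [EventuallyEq, ae_restrict_iff' measurableSet_Icc] at h1
      filter_upwards [h1] with x hx hxI
      have h2 : y x = 0 := by simpa using hx hxI
      exact (mul_eq_zero.1 h2).resolve_left (Real.exp_pos _).ne'
    · constructor
      · intro x hx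
        rw [intervalIntegral.integral_ofReal, ← Complex.ofReal_add]
        exact congrArg _ (hyd.eq_integral (hzc.intervalIntegrable _ _) x hx)
      · intro x hx
        have hint : ∫ t in a..x, (hwmem.toLp _) t = ∫ t in a..x, ((-(E - V t) * y t : ℝ) : ℂ) := by
          refine intervalIntegral.integral_congr_ae_restrict ?_
          refine ae_restrict_of_ae_restrict_of_subset ?_ hw
          rw [uIoc_of_le hx.1]
          exact fun t ht => ⟨ht.1.le, ht.2.trans hx.2⟩
        rw [hint, intervalIntegral.integral_ofReal, ← Complex.ofReal_add]
        exact congrArg _ (hzd.eq_integral hwi' x hx)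
      · simp [hy, hθa]
      · simp [hy, hs]
    · filter_upwards [hu, hw, Lp.coeFn_smul (E : ℂ) (hmem.toLp _)] with x h1 h2 h3
      rw [h3, h2, Pi.smul_apply, h1, smul_eq_mul]
      push_cast
      ring

/-! ### The phase as a function of the energy, and the list of levels -/

/-- `Φ E` is the value at `b` of the Prüfer angle for `-f'' + V f = E f` that vanishes at `a`. -/
def IsPruferPhase (V : ℝ → ℝ) (a b : ℝ) (Φ : ℝ → ℝ) : Prop :=
  ∀ E, ∃ θ : ℝ → ℝ, Continuous θ ∧ θ a = 0 ∧ IsPruferAngle (fun x => E - V x) θ a b ∧ θ b = Φ E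

theorem abs_sub_le_add {V : ℝ → ℝ} {K : ℝ} (hK : ∀ x, |V x| ≤ K) (E x : ℝ) :
    |E - V x| ≤ |E| + K := (abs_sub _ _).trans (by linarith [hK x])

theorem exists_isPruferPhase {V : ℝ → ℝ} {a b K : ℝ} (hab : a < b) (hV : AEMeasurable V volume)
    (hK : ∀ x, |V x| ≤ K) : ∃ Φ, IsPruferPhase V a b Φ := by
  choose θ h₁ h₂ h₃ using fun E : ℝ =>
    exists_isPruferAngle hab (hV.const_sub E) (abs_sub_le_add hK E)
  exact ⟨fun E => θ E b, fun E => ⟨θ E, h₁ E, h₂ E, h₃ E, rfl⟩⟩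

namespace IsPruferPhase

variable {V W Φ Ψ : ℝ → ℝ} {a b K C : ℝ}

theorem strictMono (h : IsPruferPhase V a b Φ) (hab : a < b) (hK : ∀ x, |V x| ≤ K) :
    StrictMono Φ := by
  intro E F hEF
  obtain ⟨θ, -, hθ, h1, h2⟩ := h E
  obtain ⟨η, -, hη, h3, h4⟩ := h F
  rw [← h2, ← h4]
  exact h1.lt_right hEF hab h3 (abs_sub_le_add hK F) (hθ.trans hη.symm)

theorem le_add (h : IsPruferPhase V a b Φ) (h' : IsPruferPhase W a b Ψ) (hab : a < b)
    (hK : ∀ x, |W x| ≤ K) (hVW : ∀ x, W x ≤ V x + C) (E : ℝ) : Φ E ≤ Ψ (E + C) := by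
  obtain ⟨θ, -, hθ, h1, h2⟩ := h E
  obtain ⟨η, -, hη, h3, h4⟩ := h' (E + C)
  rw [← h2, ← h4]
  exact h1.le h3 (abs_sub_le_add hK _) (Eventually.of_forall fun x => by linarith [hVW x])
    (hθ.trans hη.symm).le b (right_mem_Icc.2 hab.le)

theorem continuous (h : IsPruferPhase V a b Φ) (hab : a < b) (hK : ∀ x, |V x| ≤ K) :
    Continuous Φ := by
  have hm := h.strictMono hab hK
  have key : ∀ r E F : ℝ, E ≤ F → |F| ≤ r →
      Φ F - Φ E ≤ (F - E) * ((b - a) * Real.exp (2 * (r + K + 1) * (b - a))) := by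
    intro r E F hEF hF
    obtain ⟨θ, -, hθ, h1, h2⟩ := h E
    obtain ⟨η, -, hη, h3, h4⟩ := h F
    rw [← h2, ← h4, ← mul_assoc]
    exact h1.sub_le hEF hab.le h3 (fun x => (abs_sub_le_add hK F x).trans (by linarith))
      (hθ.trans hη.symm)
  refine continuous_iff_continuousAt.2 fun E => ?_
  set M := (b - a) * Real.exp (2 * ((|E| + 1) + K + 1) * (b - a)) with hM
  have hlim : Tendsto (fun F => M * |F - E|) (𝓝 E) (𝓝 0) := by
    have : Continuous fun F => M * |F - E| := by fun_prop
    simpa using this.tendsto E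
  refine tendsto_iff_dist_tendsto_zero.2 (squeeze_zero' (Eventually.of_forall fun _ => dist_nonneg)
    ?_ hlim)
  filter_upwards [Metric.closedBall_mem_nhds E one_pos] with F hF
  rw [Metric.mem_closedBall, Real.dist_eq] at hF
  have hF1 : |F| ≤ |E| + 1 := by
    have := abs_add_le E (F - E)
    rw [add_sub_cancel] at this
    linarith
  rw [Real.dist_eq]
  rcases le_total E F with hEF | hEF
  · rw [abs_of_nonneg (sub_nonneg.2 (hm.monotone hEF)), abs_of_nonneg (sub_nonneg.2 hEF), mul_comm]
    exact key _ E F hEF hF1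
  · rw [abs_of_nonpos (sub_nonpos.2 (hm.monotone hEF)), abs_of_nonpos (sub_nonpos.2 hEF), neg_sub,
      neg_sub, mul_comm]
    exact key _ F E hEF (by linarith)

theorem pos (h : IsPruferPhase V a b Φ) (hab : a < b) (hK : ∀ x, |V x| ≤ K) (E : ℝ) :
    0 < Φ E := by
  obtain ⟨θ, -, hθ, h1, h2⟩ := h E
  rw [← h2]
  exact h1.right_pos hab (abs_sub_le_add hK E) hθ

theorem le_pi_div_four (h : IsPruferPhase V a b Φ) (hab : a < b) (hK : ∀ x, |V x| ≤ K) {E : ℝ}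
    (hE : E ≤ -1 - K) : Φ E ≤ Real.pi / 4 := by
  obtain ⟨θ, -, hθ, h1, h2⟩ := h E
  rw [← h2]
  exact h1.right_le_pi_div_four hab.le (fun x => by linarith [(abs_le.1 (hK x)).1]) hθ

theorem le_mul (h : IsPruferPhase V a b Φ) (hab : a < b) (hK : ∀ x, |V x| ≤ K) {E : ℝ}
    (hE : 1 ≤ E + K) : Φ E ≤ (E + K) * (b - a) := by
  obtain ⟨θ, -, hθ, h1, h2⟩ := h E
  rw [← h2]
  exact h1.right_le_mul hab.le hE (fun x => by linarith [(abs_le.1 (hK x)).1]) hθ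

theorem exists_ge (h : IsPruferPhase V a b Φ) (hab : a < b) (hK : ∀ x, |V x| ≤ K) {c : ℝ} :
    ∃ E, c ≤ Φ E := by
  -- `n` is so large that reaching angle `c` takes less than the length `b - a`.
  obtain ⟨n, hn⟩ := ((tendsto_integral_inv_one_add_mul_sin_sq c).eventually_lt_const
    (sub_pos.2 hab)).exists
  obtain ⟨θ, -, hθ, h1, h2⟩ := h (1 + n + K)
  refine ⟨1 + n + K, le_of_not_gt fun hc => hn.not_ge ?_⟩
  refine (h1.sub_le_integral (M := n) n.cast_nonneg hab.le
    (fun x => by linarith [(abs_le.1 (hK x)).2]) hθ).trans ?_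
  have hpos : ∀ φ, 0 < 1 + (n : ℝ) * Real.sin φ ^ 2 := fun φ => by positivity
  have hcont : Continuous fun φ => (1 + (n : ℝ) * Real.sin φ ^ 2)⁻¹ :=
    Continuous.inv₀ (by fun_prop) fun φ => (hpos φ).ne'
  rw [← intervalIntegral.integral_add_adjacent_intervals (b := θ b)
    (hcont.intervalIntegrable 0 _) (hcont.intervalIntegrable _ c), le_add_iff_nonneg_right]
  exact intervalIntegral.integral_nonneg (h2.trans_lt hc).le fun φ _ => (inv_pos.2 (hpos φ)).le

/-- Positivity of the phase leaves only the multiples `n π` with `n ≥ 1`, whence the shift to `k +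
1`. -/
theorem mem_eigenvalues_iff (h : IsPruferPhase V a b Φ) (hab : a < b) (hV : AEMeasurable V volume)
    (hK : ∀ x, |V x| ≤ K) {E : ℝ} :
    E ∈ eigenvalues V a b ↔ ∃ k : ℕ, Φ E = (k + 1) * Real.pi := by
  obtain ⟨θ, hc, hθ, h1, h2⟩ := h E
  rw [mem_eigenvalues_iff_sin hab hV hK hc hθ h1, h2, Real.sin_eq_zero_iff]
  constructor
  · rintro ⟨n, hn⟩
    have hpos := h.pos hab hK E
    rw [← hn] at hpos
    have hn0 : 0 < n := by exact_mod_cast pos_of_mul_pos_left hpos Real.pi_pos.le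
    refine ⟨(n - 1).toNat, ?_⟩
    have h3 : (((n - 1).toNat : ℤ) : ℝ) = (n - 1 : ℤ) := by rw [Int.toNat_of_nonneg (by omega)]
    rw [Int.cast_natCast] at h3
    rw [h3, ← hn]
    push_cast
    ring
  · rintro ⟨k, hk⟩
    exact ⟨k + 1, by rw [hk]; push_cast; ring⟩

end IsPruferPhase

theorem energy_eq_of_range {V : ℝ → ℝ} {a b : ℝ} {e : ℕ → ℝ} (he : StrictMono e)
    (h : eigenvalues V a b = range e) : ∀ k, energy V a b k = e k
  | 0 => by
    rw [energy, h]
    exact IsLeast.csInf_eq ⟨mem_range_self 0, by rintro _ ⟨m, rfl⟩; exact he.monotone m.zero_le⟩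
  | k + 1 => by
    rw [energy, h, energy_eq_of_range he h k]
    refine IsLeast.csInf_eq ⟨⟨mem_range_self _, he k.lt_succ_self⟩, ?_⟩
    rintro _ ⟨⟨m, rfl⟩, hm⟩
    exact he.monotone (he.lt_iff_lt.1 hm)

/-- The intermediate value theorem, between `π / 4` and arbitrarily large values, solves `Φ E = (k +
1) π`; strict monotonicity makes the solution unique and orders it in `k`. -/
theorem IsPruferPhase.energy_spec {V Φ : ℝ → ℝ} {a b K : ℝ} (h : IsPruferPhase V a b Φ)
    (hab : a < b) (hV : AEMeasurable V volume) (hK : ∀ x, |V x| ≤ K) :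
    StrictMono (energy V a b) ∧ range (energy V a b) = eigenvalues V a b ∧
      ∀ k : ℕ, Φ (energy V a b k) = (k + 1) * Real.pi := by
  have hm := h.strictMono hab hK
  have hex : ∀ k : ℕ, ∃ E, Φ E = (k + 1) * Real.pi := by
    intro k
    obtain ⟨F, hF⟩ := h.exists_ge hab hK (c := (k + 1) * Real.pi)
    refine mem_range_of_exists_le_of_exists_ge (h.continuous hab hK) ⟨-1 - K, ?_⟩ ⟨F, hF⟩
    refine (h.le_pi_div_four hab hK le_rfl).trans ?_
    have := mul_nonneg k.cast_nonneg Real.pi_pos.le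
    linarith [Real.pi_pos]
  choose e he using hex
  have hem : StrictMono e := by
    intro k l hkl
    rw [← hm.lt_iff_lt, he, he]
    gcongr
  have hr : eigenvalues V a b = range e := by
    ext E
    rw [h.mem_eigenvalues_iff hab hV hK]
    constructor
    · rintro ⟨k, hk⟩
      exact ⟨k, hm.injective ((he k).trans hk.symm)⟩
    · rintro ⟨k, rfl⟩
      exact ⟨k, he k⟩
  have hen : energy V a b = e := funext (energy_eq_of_range hem hr)
  rw [hen]
  exact ⟨hem, hr.symm, he⟩

/-! ### Bounds on the levels -/

/-- The bound on `W` gives `E - V ≤ (E + C) - W`, so at energy `E + C` the phase for `W` has already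
reached that for `V` at `E`. -/
theorem energy_le_add {V W : ℝ → ℝ} {a b K C : ℝ} (hab : a < b) (hV : AEMeasurable V volume)
    (hW : AEMeasurable W volume) (hKV : ∀ x, |V x| ≤ K) (hKW : ∀ x, |W x| ≤ K)
    (hVW : ∀ x, W x ≤ V x + C) (k : ℕ) : energy W a b k ≤ energy V a b k + C := by
  obtain ⟨Φ, hΦ⟩ := exists_isPruferPhase hab hV hKV
  obtain ⟨Ψ, hΨ⟩ := exists_isPruferPhase hab hW hKW
  have h := hΦ.le_add hΨ hab hKW hVW (energy V a b k)
  rw [(hΦ.energy_spec hab hV hKV).2.2 k, ← (hΨ.energy_spec hab hW hKW).2.2 k] at h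
  exact (hΨ.strictMono hab hKW).le_iff_le.1 h

theorem le_energy {V : ℝ → ℝ} {a b K : ℝ} (hab : a < b) (hV : AEMeasurable V volume)
    (hK : ∀ x, |V x| ≤ K) (k : ℕ) :
    (k + 1) * (Real.pi / (b - a)) - (K + 2) ≤ energy V a b k := by
  obtain ⟨Φ, hΦ⟩ := exists_isPruferPhase hab hV hK
  have h := (hΦ.energy_spec hab hV hK).2.2 k
  have hm := hΦ.strictMono hab hK
  have hlow : -1 - K < energy V a b k := by
    rw [← hm.lt_iff_lt, h]
    refine (hΦ.le_pi_div_four hab hK le_rfl).trans_lt ?_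
    have := mul_nonneg k.cast_nonneg Real.pi_pos.le
    linarith [Real.pi_pos]
  -- Enlarging the bound to `K + 2` secures the requirement `1 ≤ E + K` of `le_mul`, since the level
  -- exceeds `-1 - K`.
  have h2 := hΦ.le_mul hab (K := K + 2) (fun x => (hK x).trans (by linarith))
    (E := energy V a b k) (by linarith)
  rw [h] at h2
  rw [sub_le_iff_le_add, ← mul_div_assoc, div_le_iff₀ (sub_pos.2 hab)]
  exact h2

/-! ### Canonical partition functions -/

/-- A canonical sum of products is bounded through the grand-canonical one. -/
theorem sum_prod_le_exp_div_pow {x : ℕ → ℝ} (hx : ∀ k, 0 ≤ x k) (hs : Summable x) {z : ℝ}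
    (hz : 0 < z) {N : ℕ} (T : Finset {s : Finset ℕ // s.card = N}) :
    ∑ s ∈ T, ∏ k ∈ s.1, x k ≤ Real.exp (z * ∑' k, x k) / z ^ N := by
  rw [le_div_iff₀ (pow_pos hz N), Finset.sum_mul]
  -- `F` collects all levels occupied in `T`. Summing over all its subsets, of any size, yields the
  -- grand-canonical product of the `1 + z x k`.
  set F := T.biUnion fun s => s.1
  calc ∑ s ∈ T, (∏ k ∈ s.1, x k) * z ^ N = ∑ s ∈ T, ∏ k ∈ s.1, z * x k := by
        refine Finset.sum_congr rfl fun s _ => ?_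
        rw [Finset.prod_mul_distrib, Finset.prod_const, s.2, mul_comm]
    _ = ∑ s ∈ T.map (Function.Embedding.subtype _), ∏ k ∈ s, z * x k := by
        rw [Finset.sum_map]
        rfl
    _ ≤ ∑ s ∈ F.powerset, ∏ k ∈ s, z * x k := by
        refine Finset.sum_le_sum_of_subset_of_nonneg (fun s hs => ?_) fun s _ _ =>
          Finset.prod_nonneg fun k _ => mul_nonneg hz.le (hx k)
        obtain ⟨t, ht, rfl⟩ := Finset.mem_map.1 hs
        exact Finset.mem_powerset.2 (Finset.subset_biUnion_of_mem (fun s => s.1) ht)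
    _ = ∏ k ∈ F, (1 + z * x k) := (Finset.prod_one_add _).symm
    _ ≤ ∏ k ∈ F, Real.exp (z * x k) := by
        refine Finset.prod_le_prod (fun k _ => ?_) fun k _ => ?_
        · have := mul_nonneg hz.le (hx k)
          positivity
        · rw [add_comm]
          exact Real.add_one_le_exp _
    _ = Real.exp (z * ∑ k ∈ F, x k) := by rw [← Real.exp_sum, Finset.mul_sum]
    _ ≤ Real.exp (z * ∑' k, x k) := by
        gcongr
        exact hs.sum_le_tsum _ fun k _ => hx k

theorem boltzmannWeight_eq_prod (β : ℝ) (V : ℝ → ℝ) (a b : ℝ) {N : ℕ}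
    (s : {s : Finset ℕ // s.card = N}) :
    boltzmannWeight β V a b N s = ∏ k ∈ s.1, Real.exp (-β * energy V a b k) := by
  rw [boltzmannWeight, Finset.mul_sum, Real.exp_sum]

theorem boltzmannWeight_pos (β : ℝ) (V : ℝ → ℝ) (a b : ℝ) {N : ℕ}
    (s : {s : Finset ℕ // s.card = N}) : 0 < boltzmannWeight β V a b N s := Real.exp_pos _

theorem summable_boltzmannWeight {β : ℝ} {V : ℝ → ℝ} {a b : ℝ}
    (h : Summable fun k => Real.exp (-β * energy V a b k)) (N : ℕ) :
    Summable (boltzmannWeight β V a b N) := by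
  refine summable_of_sum_le (fun s => (boltzmannWeight_pos β V a b s).le) (fun T => ?_)
    (c := Real.exp (1 * ∑' k, Real.exp (-β * energy V a b k)) / 1 ^ N)
  simp_rw [boltzmannWeight_eq_prod]
  exact sum_prod_le_exp_div_pow (fun k => (Real.exp_pos _).le) h one_pos T

theorem partitionFunction_pos {β : ℝ} {V : ℝ → ℝ} {a b : ℝ}
    (h : Summable fun k => Real.exp (-β * energy V a b k)) (N : ℕ) :
    0 < partitionFunction β V a b N :=
  (summable_boltzmannWeight h N).tsum_pos (fun s => (boltzmannWeight_pos β V a b s).le)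
    ⟨Finset.range N, Finset.card_range N⟩ (boltzmannWeight_pos β V a b _)

/-- The fugacity `z = N / A` minimizes `exp (z A) / z ^ N`. -/
theorem log_partitionFunction_le {β : ℝ} {V : ℝ → ℝ} {a b A : ℝ} {N : ℕ} (hN : 0 < N)
    (h : Summable fun k => Real.exp (-β * energy V a b k)) (hA0 : 0 < A)
    (hA : ∑' k, Real.exp (-β * energy V a b k) ≤ A) :
    Real.log (partitionFunction β V a b N) ≤ N * (1 - Real.log (N / A)) := by
  have hN0 : (0 : ℝ) < N := by exact_mod_cast hN
  have hz : (0 : ℝ) < N / A := div_pos hN0 hA0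
  have h1 : partitionFunction β V a b N ≤ Real.exp N / (N / A) ^ N := by
    refine (summable_boltzmannWeight h N).tsum_le_of_sum_le fun T => ?_
    simp_rw [boltzmannWeight_eq_prod]
    refine (sum_prod_le_exp_div_pow (fun k => (Real.exp_pos _).le) h hz T).trans ?_
    gcongr
    refine (mul_le_mul_of_nonneg_left hA hz.le).trans_eq ?_
    field_simp
  refine (Real.log_le_log (partitionFunction_pos h N) h1).trans_eq ?_
  rw [Real.log_div (Real.exp_pos _).ne' (pow_pos hz N).ne', Real.log_exp, Real.log_pow]
  ring

theorem log_partitionFunction_le_add {β : ℝ} {V W : ℝ → ℝ} {a b C : ℝ} (hβ : 0 < β)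
    (hV : Summable fun k => Real.exp (-β * energy V a b k))
    (hW : Summable fun k => Real.exp (-β * energy W a b k))
    (h : ∀ k, energy W a b k ≤ energy V a b k + C) (N : ℕ) :
    Real.log (partitionFunction β V a b N) ≤
      β * C * N + Real.log (partitionFunction β W a b N) := by
  have h1 : partitionFunction β V a b N ≤
      Real.exp (β * C * N) * partitionFunction β W a b N := by
    rw [partitionFunction, partitionFunction, ← tsum_mul_left]
    refine (summable_boltzmannWeight hV N).tsum_le_tsum (fun s => ?_)
      ((summable_boltzmannWeight hW N).mul_left _)
    rw [boltzmannWeight, boltzmannWeight, ← Real.exp_add, Real.exp_le_exp]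
    have h2 : ∑ k ∈ s.1, energy W a b k ≤ ∑ k ∈ s.1, energy V a b k + N * C := by
      refine (Finset.sum_le_sum fun k _ => h k).trans_eq ?_
      rw [Finset.sum_add_distrib, Finset.sum_const, s.2, nsmul_eq_mul]
    nlinarith
  refine (Real.log_le_log (partitionFunction_pos hV N) h1).trans_eq ?_
  rw [Real.log_mul (Real.exp_pos _).ne' (partitionFunction_pos hW N).ne', Real.log_exp]

/-! ### The one-particle partition function -/

section OneParticle

variable {β : ℝ} {V : ℝ → ℝ} {a b K : ℝ}

theorem exp_energy_le (hβ : 0 < β) (hab : a < b) (hV : AEMeasurable V volume)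
    (hK : ∀ x, |V x| ≤ K) (k : ℕ) : Real.exp (-β * energy V a b k) ≤
      Real.exp (β * (K + 2)) * Real.exp (-(β * Real.pi / (b - a))) *
        Real.exp (-(β * Real.pi / (b - a))) ^ k := by
  rw [mul_assoc, ← pow_succ', ← Real.exp_nat_mul, ← Real.exp_add, Real.exp_le_exp]
  have h := mul_le_mul_of_nonneg_left (le_energy hab hV hK k) hβ.le
  push_cast
  have h2 : β * Real.pi / (b - a) = β * (Real.pi / (b - a)) := mul_div_assoc _ _ _
  rw [h2]
  linarith

theorem exp_neg_div_lt_one (hβ : 0 < β) (hab : a < b) :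
    Real.exp (-(β * Real.pi / (b - a))) < 1 := by
  rw [Real.exp_lt_one_iff, neg_lt_zero]
  exact div_pos (mul_pos hβ Real.pi_pos) (sub_pos.2 hab)

theorem summable_exp_energy (hβ : 0 < β) (hab : a < b) (hV : AEMeasurable V volume)
    (hK : ∀ x, |V x| ≤ K) : Summable fun k => Real.exp (-β * energy V a b k) :=
  Summable.of_nonneg_of_le (fun _ => (Real.exp_pos _).le) (exp_energy_le hβ hab hV hK)
    ((summable_geometric_of_lt_one (Real.exp_pos _).le (exp_neg_div_lt_one hβ hab)).mul_left _)

/-- With `t = β π / (b - a)` the geometric majorant sums to `exp (-t) / (1 - exp (-t))`, which is at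
most `1 / t`, hence linear in the length. -/
theorem tsum_exp_energy_le (hβ : 0 < β) (hab : a < b) (hV : AEMeasurable V volume)
    (hK : ∀ x, |V x| ≤ K) : ∑' k, Real.exp (-β * energy V a b k) ≤
      Real.exp (β * (K + 2)) / (β * Real.pi) * (b - a) := by
  have hr := exp_neg_div_lt_one hβ hab
  have ht : 0 < β * Real.pi / (b - a) := div_pos (mul_pos hβ Real.pi_pos) (sub_pos.2 hab)
  refine ((summable_exp_energy hβ hab hV hK).tsum_le_tsum (exp_energy_le hβ hab hV hK)
    ((summable_geometric_of_lt_one (Real.exp_pos _).le hr).mul_left _)).trans ?_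
  rw [tsum_mul_left, tsum_geometric_of_lt_one (Real.exp_pos _).le hr, mul_assoc, div_mul_eq_mul_div,
    mul_div_assoc _ (b - a), ← inv_div (β * Real.pi)]
  refine mul_le_mul_of_nonneg_left ?_ (Real.exp_pos _).le
  rw [← div_eq_mul_inv, div_le_iff₀ (sub_pos.2 hr), inv_mul_eq_div, le_div_iff₀ ht]
  set t := β * Real.pi / (b - a)
  have h1 := mul_le_mul_of_nonneg_left (Real.add_one_le_exp t) (Real.exp_pos (-t)).le
  rw [← Real.exp_add, neg_add_cancel, Real.exp_zero] at h1
  linarith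

end OneParticle

end FermiGas

end

/-- For every bounded potential the eigenvalues form an infinite increasing list and all partition
functions are convergent sums, and `ln Z_N^{(V)} / ln Z_N^{(0)} → 1` along every net of particle
numbers `N` and intervals `[a, b]` with `N → ∞`, `b - a → ∞`, `N / (b - a) → ∞`. -/
theorem theorem1 (β : ℝ) (hβ : 0 < β) (V : ℝ → ℝ) (hVm : AEMeasurable V volume)
    (hVb : ∃ C : ℝ, ∀ x, |V x| ≤ C) :
    (∀ a b : ℝ, a < b →
      StrictMono (FermiGas.energy V a b) ∧
      Set.range (FermiGas.energy V a b) = FermiGas.eigenvalues V a b ∧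
      ∀ N : ℕ, Summable (FermiGas.boltzmannWeight β V a b N)) ∧
    (∀ {ι : Type*} (l : Filter ι) (N : ι → ℕ) (a b : ι → ℝ),
      Tendsto N l atTop →
      Tendsto (fun i => b i - a i) l atTop →
      Tendsto (fun i => (N i : ℝ) / (b i - a i)) l atTop →
      Tendsto (fun i =>
        Real.log (FermiGas.partitionFunction β V (a i) (b i) (N i)) /
          Real.log (FermiGas.partitionFunction β (fun _ => 0) (a i) (b i) (N i)))
        l (𝓝 1)) := by
  obtain ⟨C, hC⟩ := hVb
  have hC0 : 0 ≤ C := (abs_nonneg _).trans (hC 0)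
  have h0 : ∀ x : ℝ, |(fun _ => 0 : ℝ → ℝ) x| ≤ C := by simpa using hC0
  have h0m : AEMeasurable (fun _ => 0 : ℝ → ℝ) volume := aemeasurable_const
  refine ⟨fun a b hab => ?_, fun {ι} l N a b hN hL hd => ?_⟩
  · obtain ⟨Φ, hΦ⟩ := FermiGas.exists_isPruferPhase hab hVm hC
    obtain ⟨h1, h2, -⟩ := hΦ.energy_spec hab hVm hC
    exact ⟨h1, h2, FermiGas.summable_boltzmannWeight (FermiGas.summable_exp_energy hβ hab hVm hC)⟩
  · set c := Real.exp (β * (C + 2)) / (β * Real.pi) with hc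
    have hc0 : 0 < c := div_pos (Real.exp_pos _) (mul_pos hβ Real.pi_pos)
    -- `N v` is the lower bound for `-log Z` of the free gas when `A = c (b - a)`.
    set v : ι → ℝ := fun i => Real.log ((N i : ℝ) / (b i - a i) / c) - 1 with hv
    have hvt : Tendsto v l atTop :=
      tendsto_atTop_add_const_right _ _ (Real.tendsto_log_atTop.comp (hd.atTop_div_const hc0))
    have hlim : Tendsto (fun i => β * C / v i) l (𝓝 0) := hvt.const_div_atTop _
    refine tendsto_iff_dist_tendsto_zero.2 (squeeze_zero'
      (Eventually.of_forall fun _ => dist_nonneg) ?_ hlim)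
    filter_upwards [hN.eventually_gt_atTop 0, hL.eventually_gt_atTop 0, hvt.eventually_gt_atTop 0]
      with i hNi hLi hvi
    have hab : a i < b i := sub_pos.1 hLi
    have hNi' : (0 : ℝ) < N i := by exact_mod_cast hNi
    have hsV := FermiGas.summable_exp_energy hβ hab hVm hC
    have hs0 := FermiGas.summable_exp_energy hβ hab h0m h0
    have h1 := FermiGas.log_partitionFunction_le_add hβ hsV hs0
      (FermiGas.energy_le_add (C := C) hab hVm h0m hC h0 fun x => by linarith [(abs_le.1 (hC x)).1]) (N i)
    have h2 := FermiGas.log_partitionFunction_le_add hβ hs0 hsV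
      (FermiGas.energy_le_add (C := C) hab h0m hVm h0 hC fun x => by linarith [(abs_le.1 (hC x)).2]) (N i)
    have h3 := FermiGas.log_partitionFunction_le hNi hs0 (mul_pos hc0 hLi)
      (FermiGas.tsum_exp_energy_le hβ hab h0m h0)
    have h4 : Real.log (N i / (c * (b i - a i))) - 1 = v i := by
      simp only [hv, div_div, mul_comm c]
    set x := Real.log (FermiGas.partitionFunction β V (a i) (b i) (N i))
    set y := Real.log (FermiGas.partitionFunction β (fun _ => 0) (a i) (b i) (N i))
    have h5 : N i * v i ≤ -y := by
      rw [← h4]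
      linarith
    have hy : y < 0 := by
      have := mul_pos hNi' hvi
      linarith
    -- Since `y < 0`, the claim is `|x - y| / (-y) ≤ β C / v`, which follows from `|x - y| ≤ β C N`
    -- and `N v ≤ -y`.
    rw [Real.dist_eq, div_sub_one hy.ne, abs_div, abs_of_neg hy, div_le_div_iff₀ (neg_pos.2 hy) hvi]
    have h6 : |x - y| ≤ β * C * N i := abs_le.2 ⟨by linarith, by linarith⟩
    calc |x - y| * v i ≤ β * C * N i * v i := by gcongr
      _ = β * C * (N i * v i) := by ring
      _ ≤ β * C * -y := by gcongr
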